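/- **Theorem (Scalar parameterization of conductivity in $\mathbb{R}^2$).** Let $\Omega\subset\mathbb{R}^2$ be a bounded convex open set and let $R=\begin{pmatrix}0&-1\\1&0\end{pmatrix}$ be the rotation matrix by the angle $\pi/2$. Let $\mathcal{M}_{\mathrm{div}}$ be the set of matrix fields $Q:\Omega\to\mathbb{R}^{2\times 2}$, modulo equality almost everywhere, such that $Q$ has entries in $L^1(\Omega)$; $Q(x)$ is symmetric and positive definite for almost every $x\in\Omega$; $Q$ is divergence-free, that is, $\int_\Omega(\nabla v)^T Q\,l\,dx=0$ for all $v\in C_0^\infty(\Omega)$ and all $l\in\mathbb{R}^2$; and $\det Q$ is uniformly bounded away from $0$ and $\infty$, that is, there are constants $0<c\le C$ with $c\le\det Q\le C$ almost everywhere in $\Omega$. Let $\mathcal{S}$ be the set of convex functions $s:\Omega\to\mathbb{R}$ of class $W^{2,1}(\Omega)$ for which the determinant of the (weak) Hessian is uniformly bounded away from $0$ and $\infty$, modulo the relation $s\sim s'$ if $s-s'$ is an affine function on $\Omega$. Then for each $Q\in\mathcal{M}_{\mathrm{div}}$ there exists a unique $s\in\mathcal{S}$ such that $$\operatorname{Hess}s=R^TQR,$$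 where $\operatorname{Hess} s$ is the weak Hessian of $s$, the equality holding almost everywhere in $\Omega$. Moreover, the map $\mathcal{M}_{\mathrm{div}}\to\mathcal{S}$ sending $Q$ to this $s$ is a bijection. -/

import Mathlib

open MeasureTheory
open scoped ContDiff Matrix

noncomputable section

/-- The Euclidean plane. -/
abbrev Plane : Type := EuclideanSpace ℝ (Fin 2)

/-- `2 × 2` real matrices. -/
abbrev Mat2 : Type := Matrix (Fin 2) (Fin 2) ℝ

/-- The rotation matrix by the angle `π / 2`. -/
def rotR : Mat2 := !![0, -1; 1, 0]

/-- Test functions on `Ω`: smooth functions with compact support contained in `Ω`. -/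
structure IsTestFunction (Ω : Set Plane) (φ : Plane → ℝ) : Prop where
  smooth : ContDiff ℝ ∞ φ
  hasCompactSupport : HasCompactSupport φ
  tsupport_subset : tsupport φ ⊆ Ω

/-- The classical partial derivative in the `i`-th coordinate direction. -/
def partialDeriv (i : Fin 2) (φ : Plane → ℝ) (x : Plane) : ℝ :=
  fderiv ℝ φ x (EuclideanSpace.single i 1)

/-- `v` is the weak `i`-th partial derivative of `u` on `Ω`. -/
structure HasWeakPartial (Ω : Set Plane) (i : Fin 2) (u v : Plane → ℝ) : Prop where
  locallyIntegrable_fun : LocallyIntegrableOn u Ω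
  locallyIntegrable_deriv : LocallyIntegrableOn v Ω
  integral_eq : ∀ φ : Plane → ℝ, IsTestFunction Ω φ →
    ∫ x in Ω, u x * partialDeriv i φ x = -∫ x in Ω, v x * φ x

/-- `g` is the weak gradient of `u` on `Ω`. -/
def HasWeakGradient (Ω : Set Plane) (u : Plane → ℝ) (g : Plane → Fin 2 → ℝ) : Prop :=
  ∀ i, HasWeakPartial Ω i u (fun x => g x i)

/-- `H` is the weak Hessian of `u` on `Ω`: the matrix of the weak partial derivatives of the
weak gradient of `u`. -/
def HasWeakHessian (Ω : Set Plane) (u : Plane → ℝ) (H : Plane → Mat2) : Prop :=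
  ∃ g : Plane → Fin 2 → ℝ, HasWeakGradient Ω u g ∧
    ∀ i, HasWeakGradient Ω (fun x => g x i) (fun x => H x i)

/-- Membership in the Sobolev space `W^{2,1}(Ω)`. -/
structure MemW21 (Ω : Set Plane) (u : Plane → ℝ) : Prop where
  integrable : IntegrableOn u Ω
  exists_gradient : ∃ g : Plane → Fin 2 → ℝ, HasWeakGradient Ω u g ∧
    ∀ i, IntegrableOn (fun x => g x i) Ω
  exists_hessian : ∃ H : Plane → Mat2, HasWeakHessian Ω u H ∧
    ∀ i j, IntegrableOn (fun x => H x i j) Ω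

/-- The determinant of the matrix field `M` is uniformly bounded away from `0` and `∞` on `Ω`
(the determinants are nonnegative for the fields to which this is applied). -/
def DetBounded (Ω : Set Plane) (M : Plane → Mat2) : Prop :=
  ∃ c C : ℝ, 0 < c ∧ ∀ᵐ x ∂volume.restrict Ω, c ≤ (M x).det ∧ (M x).det ≤ C

/-- The columns of `M` are weakly divergence-free vector fields on `Ω`:
`∫_Ω (∇v)ᵀ M l = 0` for all test functions `v` and all vectors `l`. -/
def IsDivergenceFree (Ω : Set Plane) (M : Plane → Mat2) : Prop :=
  ∀ v : Plane → ℝ, IsTestFunction Ω v → ∀ l : Fin 2 → ℝ,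
    ∫ x in Ω, (fun i => partialDeriv i v x) ⬝ᵥ (M x *ᵥ l) = 0

/-- The defining properties of divergence-free conductivities: `L¹` entries, symmetric and
positive definite almost everywhere (`Matrix.PosDef` includes symmetry), weakly divergence-free,
with determinant uniformly bounded away from `0` and `∞`. -/
structure IsDivFreeConductivity (Ω : Set Plane) (Q : Plane → Mat2) : Prop where
  integrable : ∀ i j, IntegrableOn (fun x => Q x i j) Ω
  posDef : ∀ᵐ x ∂volume.restrict Ω, (Q x).PosDef
  divergenceFree : IsDivergenceFree Ω Q
  detBounded : DetBounded Ω Q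

/-- Divergence-free conductivities on `Ω`, as functions. -/
abbrev DivFreeField (Ω : Set Plane) : Type := {Q : Plane → Mat2 // IsDivFreeConductivity Ω Q}

/-- Two matrix fields are identified if they agree almost everywhere on `Ω`. -/
instance divFreeSetoid (Ω : Set Plane) : Setoid (DivFreeField Ω) where
  r Q Q' := Q.1 =ᵐ[volume.restrict Ω] Q'.1
  iseqv := ⟨fun _ => Filter.EventuallyEq.rfl, fun h => h.symm, fun h h' => h.trans h'⟩

/-- The space `M_div` of divergence-free conductivities on `Ω`, modulo equality almost
everywhere. -/
abbrev MDiv (Ω : Set Plane) : Type := Quotient (divFreeSetoid Ω)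

/-- Convex functions on `Ω` of class `W^{2,1}(Ω)` for which the determinant of the Hessian is
uniformly bounded away from `0` and `∞`. -/
structure IsConvexPotential (Ω : Set Plane) (s : Plane → ℝ) : Prop where
  convexOn : ConvexOn ℝ Ω s
  memW21 : MemW21 Ω s
  detBounded : ∃ H : Plane → Mat2, HasWeakHessian Ω s H ∧ DetBounded Ω H

/-- The set of these convex functions, as functions. -/
abbrev ConvexPotential (Ω : Set Plane) : Type := {s : Plane → ℝ // IsConvexPotential Ω s}

/-- Two convex functions are identified if their difference is an affine function on `Ω`. -/
instance convexPotentialSetoid (Ω : Set Plane) : Setoid (ConvexPotential Ω) where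
  r s s' := ∃ a : Plane →ᵃ[ℝ] ℝ, ∀ x ∈ Ω, s.1 x - s'.1 x = a x
  iseqv :=
    { refl := fun s => ⟨0, fun x _ => by simp⟩
      symm := by
        rintro s s' ⟨a, ha⟩
        refine ⟨-a, fun x hx => ?_⟩
        have h := ha x hx
        simp only [AffineMap.coe_neg, Pi.neg_apply]
        linarith
      trans := by
        rintro s s' s'' ⟨a, ha⟩ ⟨b, hb⟩
        refine ⟨a + b, fun x hx => ?_⟩
        have h := ha x hx
        have h2 := hb x hx
        simp only [AffineMap.coe_add, Pi.add_apply]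
        linarith }

/-- The space `S` of convex functions modulo affine functions. -/
abbrev ConvexClass (Ω : Set Plane) : Type := Quotient (convexPotentialSetoid Ω)

end

/-! In the plane, rotation by π/2 exchanges divergence and curl. For symmetric `Q`, the rows of `Rᵀ
Q R` are therefore curl-free exactly when the columns of `Q` are divergence-free. The Poincaré lemma
`IsCurlFree.exists_hasWeakGradient` makes each row a weak gradient of some `g i`. Symmetry of `Rᵀ Q
R` says that `(g 0, g 1)` is curl-free as well, so a second application gives `s` with weak Hessian
`Rᵀ Q R`. Conversely, weak Hessians are symmetric with curl-free rows, and rotating back gives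
divergence-free columns. The determinant does not change under rotation.

Positivity corresponds to convexity. Mollification turns each into the same statement about smooth
functions: a convex function has a positive semidefinite weak Hessian
(`ConvexOn.quadForm_nonneg_ae`), and a function with such a Hessian has a convex representative
(`exists_convexOn_ae_eq`). The lower bound on the determinant upgrades semidefinite to definite.

The Poincaré lemma is the main analytic step. A line integral of an `L¹` field from a fixed base
point need not make sense, so the primitive averages the line integrals from all base points `a` in
a small ball. This average is continuous in the `L¹` norm of the field (`lintegral_segment_le`), so
the identity for smooth closed forms passes to the limit along mollifications.

Uniqueness: if two potentials share a Hessian, their gradients differ by a constant, so they differ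
almost everywhere by an affine function (`HasWeakGradient.ae_eq_affine`). Convex functions are
continuous on open sets, so the equality holds everywhere (`IsConvexPotential.exists_affine`). -/

open Set Filter Metric
open scoped Topology Convolution ENNReal

/-! ### Mollification and weak derivatives -/

/-- A sequence of smooth bump functions supported in balls of radius `1 / (n + 1)`. -/
noncomputable def bumpSeq (n : ℕ) : ContDiffBump (0 : Plane) where
  rIn := 1 / (2 * ((n : ℝ) + 1))
  rOut := 1 / ((n : ℝ) + 1)
  rIn_pos := by positivity
  rIn_lt_rOut := by
    apply one_div_lt_one_div_of_lt <;> nlinarith [(Nat.cast_nonneg n : (0 : ℝ) ≤ n)]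

theorem tendsto_bumpSeq_rOut : Tendsto (fun n => (bumpSeq n).rOut) atTop (𝓝 0) :=
  tendsto_one_div_add_atTop_nhds_zero_nat

/-- The kernel of the mollification. -/
noncomputable def mollifier (n : ℕ) : Plane → ℝ := (bumpSeq n).normed volume

/-- The mollification of the extension by zero of `u : Ω → ℝ`. -/
noncomputable def mollify (Ω : Set Plane) (n : ℕ) (u : Plane → ℝ) : Plane → ℝ :=
  convolution (mollifier n) (Ω.indicator u) (ContinuousLinearMap.lsmul ℝ ℝ) volume

theorem mollifier_contDiff (n : ℕ) : ContDiff ℝ ∞ (mollifier n) :=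
  (bumpSeq n).contDiff_normed

theorem mollifier_hasCompactSupport (n : ℕ) : HasCompactSupport (mollifier n) :=
  (bumpSeq n).hasCompactSupport_normed

theorem mollifier_nonneg (n : ℕ) (x : Plane) : 0 ≤ mollifier n x :=
  (bumpSeq n).nonneg_normed x

theorem integral_mollifier (n : ℕ) : ∫ x, mollifier n x = 1 :=
  (bumpSeq n).integral_normed

theorem mollifier_integrable (n : ℕ) : Integrable (mollifier n) :=
  (mollifier_contDiff n).continuous.integrable_of_hasCompactSupport (mollifier_hasCompactSupport n)

theorem mollify_apply {Ω : Set Plane} (hΩ : MeasurableSet Ω) (n : ℕ) (u : Plane → ℝ) (x : Plane) :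
    mollify Ω n u x = ∫ y in Ω, mollifier n (x - y) * u y := by
  rw [mollify, convolution_eq_swap, ← integral_indicator hΩ]
  congr 1
  ext y
  by_cases hy : y ∈ Ω <;> simp [hy]

theorem mollify_contDiff {Ω : Set Plane} (hΩ : MeasurableSet Ω) {u : Plane → ℝ}
    (hu : IntegrableOn u Ω) (n : ℕ) : ContDiff ℝ ∞ (mollify Ω n u) :=
  (mollifier_hasCompactSupport n).contDiff_convolution_left _ (mollifier_contDiff n)
    (hu.integrable_indicator hΩ).locallyIntegrable

theorem mollify_tendsto_ae {Ω : Set Plane} (hΩ : MeasurableSet Ω) {u : Plane → ℝ}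
    (hu : IntegrableOn u Ω) :
    ∀ᵐ x ∂volume.restrict Ω, Tendsto (fun n => mollify Ω n u x) atTop (𝓝 (u x)) := by
  -- The outer radius is exactly twice the inner one, which gives the bounded ratio that Lebesgue
  -- differentiation needs.
  have h := ContDiffBump.ae_convolution_tendsto_right_of_locallyIntegrable (K := 2)
    (φ := bumpSeq) (μ := volume) tendsto_bumpSeq_rOut
    (Eventually.of_forall fun n => le_of_eq (by
      simp only [bumpSeq]; field_simp)) (hu.integrable_indicator hΩ).locallyIntegrable
  rw [ae_restrict_iff' hΩ]
  filter_upwards [h] with x hx hxΩ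
  rwa [Set.indicator_of_mem hxΩ] at hx

theorem partialDeriv_mollify {Ω : Set Plane} (hΩ : MeasurableSet Ω) {u : Plane → ℝ}
    (hu : IntegrableOn u Ω) (n : ℕ) (i : Fin 2) (x : Plane) :
    partialDeriv i (mollify Ω n u) x =
      ∫ y in Ω, partialDeriv i (mollifier n) (x - y) * u y := by
  have h := (mollifier_hasCompactSupport n).hasFDerivAt_convolution_left
    (ContinuousLinearMap.lsmul ℝ ℝ) ((mollifier_contDiff n).of_le (by simp))
    (hu.integrable_indicator hΩ).locallyIntegrable x
  have h2 : HasFDerivAt (mollify Ω n u) _ x := h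
  rw [partialDeriv, h2.fderiv, convolution_eq_swap, ← integral_indicator hΩ,
    ContinuousLinearMap.integral_apply]
  · congr 1
    ext y
    by_cases hy : y ∈ Ω <;> simp [hy, partialDeriv, ContinuousLinearMap.precompL_apply]
  · have := ((mollifier_hasCompactSupport n).fderiv ℝ).convolutionExists_left
      ((ContinuousLinearMap.lsmul ℝ ℝ).precompL Plane)
      ((mollifier_contDiff n).continuous_fderiv (by simp))
      (hu.integrable_indicator hΩ).locallyIntegrable x
    exact this.integrable_swap

theorem isTestFunction_mollifier_sub {Ω : Set Plane} {n : ℕ} {x : Plane}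
    (hx : closedBall x (bumpSeq n).rOut ⊆ Ω) :
    IsTestFunction Ω (fun y => mollifier n (x - y)) := by
  have hs : tsupport (fun y => mollifier n (x - y)) ⊆ closedBall x (bumpSeq n).rOut := by
    refine closure_minimal ?_ isClosed_closedBall
    intro y hy
    have : x - y ∈ Function.support (mollifier n) := hy
    rw [mollifier, (bumpSeq n).support_normed_eq] at this
    rw [mem_closedBall, dist_eq_norm, norm_sub_rev]
    exact (mem_ball_zero_iff.1 this).le
  exact ⟨(mollifier_contDiff n).comp (contDiff_const.sub contDiff_id),
    (isCompact_closedBall _ _).of_isClosed_subset (isClosed_tsupport _) hs, hs.trans hx⟩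

theorem partialDeriv_mollifier_sub (n : ℕ) (i : Fin 2) (x y : Plane) :
    partialDeriv i (fun y => mollifier n (x - y)) y = - partialDeriv i (mollifier n) (x - y) := by
  have h1 : HasFDerivAt (mollifier n) (fderiv ℝ (mollifier n) (x - y)) (x - y) :=
    ((mollifier_contDiff n).differentiable (by simp) _).hasFDerivAt
  have h2 : HasFDerivAt (fun y : Plane => x - y) (-ContinuousLinearMap.id ℝ Plane) y :=
    (hasFDerivAt_id y).const_sub x
  have h3 : HasFDerivAt (fun y => mollifier n (x - y)) _ y := h1.comp y h2
  rw [partialDeriv, h3.fderiv]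
  simp [partialDeriv]

/-- Mollification commutes with weak derivatives away from the boundary. -/
theorem HasWeakPartial.partialDeriv_mollify {Ω : Set Plane} (hΩ : MeasurableSet Ω) {i : Fin 2}
    {u v : Plane → ℝ} (h : HasWeakPartial Ω i u v) (hu : IntegrableOn u Ω) {n : ℕ} {x : Plane}
    (hx : closedBall x (bumpSeq n).rOut ⊆ Ω) :
    partialDeriv i (mollify Ω n u) x = mollify Ω n v x := by
  have := h.integral_eq _ (isTestFunction_mollifier_sub hx)
  rw [_root_.partialDeriv_mollify hΩ hu, mollify_apply hΩ]
  simp only [partialDeriv_mollifier_sub, mul_neg, integral_neg, neg_inj] at this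
  simpa only [mul_comm] using this

/-- The vector field `F` is weakly curl-free on `Ω`. -/
def IsCurlFree (Ω : Set Plane) (F : Plane → Fin 2 → ℝ) : Prop :=
  ∀ φ, IsTestFunction Ω φ →
    ∫ x in Ω, F x 0 * partialDeriv 1 φ x = ∫ x in Ω, F x 1 * partialDeriv 0 φ x

/-- The reflected and translated kernel `y ↦ mollifier n (x - y)` is a legitimate test function once
the closed ball about `x` lies in `Ω`. Testing with it gives classical closedness at `x`. -/
theorem IsCurlFree.partialDeriv_mollify {Ω : Set Plane} (hΩ : MeasurableSet Ω)
    {F : Plane → Fin 2 → ℝ} (h : IsCurlFree Ω F) (hF : ∀ i, IntegrableOn (fun x => F x i) Ω)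
    {n : ℕ} {x : Plane} (hx : closedBall x (bumpSeq n).rOut ⊆ Ω) :
    partialDeriv 1 (mollify Ω n fun x => F x 0) x =
      partialDeriv 0 (mollify Ω n fun x => F x 1) x := by
  have := h _ (isTestFunction_mollifier_sub hx)
  rw [_root_.partialDeriv_mollify hΩ (hF 0), _root_.partialDeriv_mollify hΩ (hF 1)]
  simp only [partialDeriv_mollifier_sub, mul_neg, integral_neg, neg_inj] at this
  simpa only [mul_comm] using this

theorem fderiv_apply_eq_sum_partialDeriv (f : Plane → ℝ) (x v : Plane) :
    fderiv ℝ f x v = v 0 * partialDeriv 0 f x + v 1 * partialDeriv 1 f x := by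
  have hv : v = v 0 • EuclideanSpace.single 0 1 + v 1 • EuclideanSpace.single 1 1 := by
    ext i
    fin_cases i <;> simp
  conv_lhs => rw [hv]
  simp [partialDeriv]

theorem eventually_closedBall_bumpSeq_subset {Ω : Set Plane} (hΩ : IsOpen Ω) {x : Plane} (hx : x ∈ Ω) :
    ∀ᶠ n in atTop, closedBall x (bumpSeq n).rOut ⊆ Ω := by
  obtain ⟨ε, hε, h⟩ := Metric.isOpen_iff.1 hΩ x hx
  filter_upwards [tendsto_bumpSeq_rOut.eventually (gt_mem_nhds hε)] with n hn
  exact (closedBall_subset_ball hn).trans h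

/-- The inner parallel sets of a convex set are convex: a displacement `d` from the convex
combination can be applied to both endpoints at once. -/
theorem closedBall_subset_of_segment {Ω : Set Plane} (hΩ : Convex ℝ Ω) {x y : Plane} {r : ℝ}
    (hx : closedBall x r ⊆ Ω) (hy : closedBall y r ⊆ Ω) {a b : ℝ} (ha : 0 ≤ a) (hb : 0 ≤ b)
    (hab : a + b = 1) : closedBall (a • x + b • y) r ⊆ Ω := by
  intro w hw
  set d := w - (a • x + b • y) with hd
  have hd' : ‖d‖ ≤ r := by rwa [hd, ← dist_eq_norm]
  have hw' : w = a • (x + d) + b • (y + d) := by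
    have : a • (x + d) + b • (y + d) = a • x + b • y + (a + b) • d := by module
    rw [this, hab, hd]; module
  rw [hw']
  exact hΩ (hx (by simpa using hd')) (hy (by simpa using hd')) ha hb hab

/-! ### Convergence of mollifications in `L¹` -/

/-- Young's inequality for a nonnegative kernel of mass one: convolution is an `L¹` contraction, so
approximation errors survive mollification. -/
theorem integral_norm_convolution_mollifier_le (n : ℕ) {w : Plane → ℝ} (hw : Integrable w) :
    Integrable (convolution (mollifier n) w (ContinuousLinearMap.lsmul ℝ ℝ) volume) ∧
    ∫ x, ‖convolution (mollifier n) w (ContinuousLinearMap.lsmul ℝ ℝ) volume x‖ ≤ ∫ x, ‖w x‖ := by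
  have hi := (mollifier_integrable n).integrable_convolution (ContinuousLinearMap.lsmul ℝ ℝ) hw
  refine ⟨hi, ?_⟩
  have hi' := (mollifier_integrable n).integrable_convolution (ContinuousLinearMap.lsmul ℝ ℝ)
    hw.norm
  calc _ ≤ ∫ x, convolution (mollifier n) (fun x => ‖w x‖)
        (ContinuousLinearMap.lsmul ℝ ℝ) volume x := by
        refine integral_mono hi.norm hi' fun x => ?_
        simp only [convolution]
        refine (norm_integral_le_integral_norm _).trans (le_of_eq ?_)
        congr 1
        ext t
        simp [abs_of_nonneg (mollifier_nonneg n t)]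
    _ = ∫ x, ‖w x‖ := by
        rw [integral_convolution _ (mollifier_integrable n) hw.norm, integral_mollifier]
        simp

theorem mollify_integrable {Ω : Set Plane} (hΩ : MeasurableSet Ω) {u : Plane → ℝ}
    (hu : IntegrableOn u Ω) (n : ℕ) : Integrable (mollify Ω n u) :=
  (integral_norm_convolution_mollifier_le n (hu.integrable_indicator hΩ)).1

theorem integral_norm_mollify_le {Ω : Set Plane} (hΩ : MeasurableSet Ω) {u : Plane → ℝ}
    (hu : IntegrableOn u Ω) (n : ℕ) : ∫ x, ‖mollify Ω n u x‖ ≤ ∫ x in Ω, ‖u x‖ := by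
  refine (integral_norm_convolution_mollifier_le n (hu.integrable_indicator hΩ)).2.trans
    (le_of_eq ?_)
  simp_rw [norm_indicator_eq_indicator_norm]
  exact integral_indicator hΩ

/-- Mollifications converge in `L¹(Ω)`. -/
theorem mollify_tendsto_integral_norm {Ω : Set Plane} (hΩ : MeasurableSet Ω)
    (hb : Bornology.IsBounded Ω) {u : Plane → ℝ} (hu : IntegrableOn u Ω) :
    Tendsto (fun n => ∫ x in Ω, ‖mollify Ω n u x - u x‖) atTop (𝓝 0) := by
  set w := Ω.indicator u with hw
  have hwi : Integrable w := hu.integrable_indicator hΩ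
  have hfin : volume Ω < ⊤ := hb.measure_lt_top
  have : IsFiniteMeasure (volume.restrict Ω) := ⟨by simpa using hfin⟩
  rw [Metric.tendsto_atTop]
  intro ε hε
  obtain ⟨c, hc, hcw, hcc, hci⟩ := hwi.exists_hasCompactSupport_integral_sub_le
    (show (0 : ℝ) < ε / 4 by positivity)
  set V := volume.real Ω with hV
  have hV0 : 0 ≤ V := measureReal_nonneg
  -- With `V + 1` in place of `V`, `η` is defined even when `V = 0`, and `η V ≤ ε / 4`. The three
  -- errors then add up to at most `3 ε / 4 < ε`.
  set η := ε / (4 * (V + 1)) with hη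
  have hη0 : 0 < η := by positivity
  have huc := hc.uniformContinuous_of_continuous hcc
  obtain ⟨δ, hδ, hδc⟩ := Metric.uniformContinuous_iff.1 huc η hη0
  obtain ⟨N, hN⟩ := eventually_atTop.1 (tendsto_bumpSeq_rOut.eventually (gt_mem_nhds hδ))
  refine ⟨N, fun n hn => ?_⟩
  let C (g : Plane → ℝ) := convolution (mollifier n) g (ContinuousLinearMap.lsmul ℝ ℝ) volume
  have hCc : ∀ x, ‖C c x - c x‖ ≤ η := fun x => by
    rw [← dist_eq_norm]
    exact (bumpSeq n).dist_normed_convolution_le hcc.aestronglyMeasurable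
      fun y hy => (hδc ((mem_ball.1 hy).trans (hN n hn))).le
  obtain ⟨hd1, hd2⟩ := integral_norm_convolution_mollifier_le n (hwi.sub hci)
  have hCci : Integrable (C c) := (integral_norm_convolution_mollifier_le n hci).1
  have hsub : ∀ x, C w x = C (w - c) x + C c x := by
    intro x
    have h1 : ∀ g : Plane → ℝ, Integrable g → ConvolutionExistsAt (mollifier n) g x
        (ContinuousLinearMap.lsmul ℝ ℝ) volume := fun g hg =>
      (mollifier_hasCompactSupport n).convolutionExists_left _ (mollifier_contDiff n).continuous
        hg.locallyIntegrable x
    have h2 := (h1 (w - c) (hwi.sub hci)).distrib_add (h1 c hci)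
    rw [sub_add_cancel] at h2
    exact h2
  have hpt : ∀ x ∈ Ω, ‖mollify Ω n u x - u x‖ ≤ ‖C (w - c) x‖ + η + ‖w x - c x‖ := by
    intro x hx
    have e1 : mollify Ω n u x - u x = C (w - c) x + (C c x - c x) + (c x - w x) := by
      have : u x = w x := by simp [hw, hx]
      have h3 : mollify Ω n u x = C w x := rfl
      rw [h3, hsub, this]; ring
    rw [e1]
    refine (norm_add₃_le).trans ?_
    rw [norm_sub_rev (c x)]
    linarith [hCc x]
  have hint : ∫ x in Ω, ‖mollify Ω n u x - u x‖ ≤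
      ∫ x in Ω, (‖C (w - c) x‖ + η + ‖w x - c x‖) := by
    refine setIntegral_mono_on ?_ ?_ hΩ hpt
    · exact ((mollify_integrable hΩ hu n).integrableOn.sub hu).norm
    · exact (hd1.norm.integrableOn.add (integrable_const η)).add (hwi.sub hci).norm.integrableOn
  have hsum : ∫ x in Ω, (‖C (w - c) x‖ + η + ‖w x - c x‖) =
      (∫ x in Ω, ‖C (w - c) x‖) + (∫ _ in Ω, η) + ∫ x in Ω, ‖w x - c x‖ := by
    have j1 : Integrable (fun x => ‖C (w - c) x‖) (volume.restrict Ω) := hd1.norm.integrableOn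
    have j2 : Integrable (fun x => ‖w x - c x‖) (volume.restrict Ω) :=
      (hwi.sub hci).norm.integrableOn
    have j3 : Integrable (fun x => ‖C (w - c) x‖ + η) (volume.restrict Ω) :=
      j1.add (integrable_const η)
    rw [integral_add j3 j2, integral_add j1 (integrable_const η)]
  have i1 : ∫ x in Ω, ‖C (w - c) x‖ ≤ ε / 4 :=
    (setIntegral_le_integral hd1.norm (Eventually.of_forall fun _ => norm_nonneg _)).trans
      (hd2.trans hcw)
  have i2 : ∫ x in Ω, ‖w x - c x‖ ≤ ε / 4 :=
    (setIntegral_le_integral (hwi.sub hci).norm (Eventually.of_forall fun _ => norm_nonneg _)).trans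
      hcw
  have i3 : ∫ _ in Ω, η ≤ ε / 4 := by
    rw [setIntegral_const, smul_eq_mul, ← hV, hη, ← mul_div_assoc, div_le_div_iff₀ (by positivity)
      (by positivity)]
    nlinarith
  rw [dist_zero_right, Real.norm_of_nonneg (integral_nonneg fun _ => norm_nonneg _)]
  linarith

/-! ### Calculus of weak derivatives -/

theorem IsTestFunction.partialDeriv {Ω : Set Plane} {φ : Plane → ℝ} (h : IsTestFunction Ω φ)
    (i : Fin 2) : IsTestFunction Ω (partialDeriv i φ) := by
  refine ⟨?_, h.hasCompactSupport.fderiv_apply ℝ _, ?_⟩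
  · exact (h.smooth.fderiv_right (m := ∞) (by simp)).clm_apply contDiff_const
  · exact (tsupport_fderiv_apply_subset ℝ _).trans h.tsupport_subset

theorem IsTestFunction.partialDeriv_comm {Ω : Set Plane} {φ : Plane → ℝ}
    (h : IsTestFunction Ω φ) (i j : Fin 2) (x : Plane) :
    _root_.partialDeriv i (_root_.partialDeriv j φ) x =
      _root_.partialDeriv j (_root_.partialDeriv i φ) x := by
  have hs : IsSymmSndFDerivAt ℝ φ x := h.smooth.contDiffAt.isSymmSndFDerivAt (by
    rw [minSmoothness_of_isRCLikeNormedField]; exact ENat.LEInfty.out)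
  have hd : DifferentiableAt ℝ (fderiv ℝ φ) x :=
    (h.smooth.fderiv_right (m := ∞) (by simp)).differentiable (by simp) x
  have key : ∀ k l : Fin 2, _root_.partialDeriv k (_root_.partialDeriv l φ) x =
      fderiv ℝ (fderiv ℝ φ) x (EuclideanSpace.single k 1) (EuclideanSpace.single l 1) := by
    intro k l
    have := (hd.hasFDerivAt.clm_apply (hasFDerivAt_const (EuclideanSpace.single l (1 : ℝ)) x))
    have e : HasFDerivAt (_root_.partialDeriv l φ) _ x := this
    rw [_root_.partialDeriv, e.fderiv]
    simp
  rw [key, key]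
  exact hs.eq _ _

theorem LocallyIntegrableOn.integrableOn_mul_testFunction {Ω : Set Plane}
    {u φ : Plane → ℝ} (hu : LocallyIntegrableOn u Ω) (hφ : IsTestFunction Ω φ) :
    IntegrableOn (fun x => u x * φ x) Ω := by
  have h1 : IntegrableOn u (tsupport φ) :=
    hu.integrableOn_compact_subset hφ.tsupport_subset hφ.hasCompactSupport
  have h2 : IntegrableOn (fun x => u x * φ x) (tsupport φ) :=
    h1.mul_continuousOn hφ.smooth.continuous.continuousOn hφ.hasCompactSupport
  refine IntegrableOn.integrable_of_forall_notMem_eq_zero h2 (fun x hx => ?_) |>.integrableOn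
  rw [image_eq_zero_of_notMem_tsupport hx, mul_zero]

/-- Fundamental lemma of the calculus of variations, applied to the difference `v - v'`. -/
theorem HasWeakPartial.ae_eq {Ω : Set Plane} (hΩ : IsOpen Ω) {i : Fin 2} {u v v' : Plane → ℝ}
    (h : HasWeakPartial Ω i u v) (h' : HasWeakPartial Ω i u v') :
    v =ᵐ[volume.restrict Ω] v' := by
  have key := hΩ.ae_eq_zero_of_integral_contDiff_smul_eq_zero (μ := volume)
    (h.locallyIntegrable_deriv.sub h'.locallyIntegrable_deriv) (fun φ h1 h2 h3 => by
      have hφ : IsTestFunction Ω φ := ⟨h1, h2, h3⟩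
      rw [← setIntegral_eq_integral_of_forall_compl_eq_zero (s := Ω) (fun x hx => by
        rw [image_eq_zero_of_notMem_tsupport fun hx' => hx (h3 hx'), zero_smul])]
      have e := (h.integral_eq φ hφ).symm.trans (h'.integral_eq φ hφ)
      have e2 : ∫ x in Ω, φ x • (v - v') x = ∫ x in Ω, (v x * φ x - v' x * φ x) := by
        congr 1; ext x; simp only [Pi.sub_apply, smul_eq_mul]; ring
      rw [e2, integral_sub
        (LocallyIntegrableOn.integrableOn_mul_testFunction
          h.locallyIntegrable_deriv hφ)
        (LocallyIntegrableOn.integrableOn_mul_testFunction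
          h'.locallyIntegrable_deriv hφ)]
      linarith)
  rw [Filter.EventuallyEq, ae_restrict_iff' hΩ.measurableSet]
  filter_upwards [key] with x hx hxΩ
  exact sub_eq_zero.1 (hx hxΩ)

theorem HasWeakPartial.congr {Ω : Set Plane} {i : Fin 2} {u u' v v' : Plane → ℝ}
    (h : HasWeakPartial Ω i u v) (hu : u =ᵐ[volume.restrict Ω] u')
    (hv : v =ᵐ[volume.restrict Ω] v') : HasWeakPartial Ω i u' v' := by
  refine ⟨h.locallyIntegrable_fun.congr hu, h.locallyIntegrable_deriv.congr hv, fun φ hφ => ?_⟩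
  have e1 : ∫ x in Ω, u' x * partialDeriv i φ x = ∫ x in Ω, u x * partialDeriv i φ x :=
    integral_congr_ae (by filter_upwards [hu] with x hx; rw [hx])
  have e2 : ∫ x in Ω, v' x * φ x = ∫ x in Ω, v x * φ x :=
    integral_congr_ae (by filter_upwards [hv] with x hx; rw [hx])
  rw [e1, e2, h.integral_eq φ hφ]

theorem HasWeakPartial.sub {Ω : Set Plane} {i : Fin 2}
    {u u' v v' : Plane → ℝ} (h : HasWeakPartial Ω i u v) (h' : HasWeakPartial Ω i u' v') :
    HasWeakPartial Ω i (fun x => u x - u' x) (fun x => v x - v' x) := by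
  refine ⟨h.locallyIntegrable_fun.sub h'.locallyIntegrable_fun,
    h.locallyIntegrable_deriv.sub h'.locallyIntegrable_deriv, fun φ hφ => ?_⟩
  have l : ∀ w w' ψ : Plane → ℝ, LocallyIntegrableOn w Ω → LocallyIntegrableOn w' Ω →
      IsTestFunction Ω ψ → ∫ x in Ω, (w x - w' x) * ψ x =
        (∫ x in Ω, w x * ψ x) - ∫ x in Ω, w' x * ψ x := fun w w' ψ hw hw' hψ => by
    simp only [sub_mul]
    exact integral_sub (LocallyIntegrableOn.integrableOn_mul_testFunction hw hψ)
      (LocallyIntegrableOn.integrableOn_mul_testFunction hw' hψ)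
  rw [l _ _ _ h.locallyIntegrable_fun h'.locallyIntegrable_fun (hφ.partialDeriv i),
    l _ _ _ h.locallyIntegrable_deriv h'.locallyIntegrable_deriv hφ,
    h.integral_eq φ hφ, h'.integral_eq φ hφ]
  ring

/-- Mixed weak second derivatives commute. -/
theorem HasWeakGradient.hasWeakPartial_comm {Ω : Set Plane} {s : Plane → ℝ}
    {g : Plane → Fin 2 → ℝ} (hg : HasWeakGradient Ω s g) {i j : Fin 2} {h : Plane → ℝ}
    (hh : HasWeakPartial Ω i (fun x => g x j) h) : HasWeakPartial Ω j (fun x => g x i) h := by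
  refine ⟨(hg i).locallyIntegrable_deriv, hh.locallyIntegrable_deriv, fun φ hφ => ?_⟩
  have e1 := (hg i).integral_eq _ (hφ.partialDeriv j)
  have e2 := (hg j).integral_eq _ (hφ.partialDeriv i)
  have e3 := hh.integral_eq φ hφ
  simp only [hφ.partialDeriv_comm i j] at e1
  linarith

/-- Each Hessian comes with its own choice of weak gradient. The gradients agree almost everywhere,
so one can be exchanged for the other before the second derivatives are compared. -/
theorem HasWeakHessian.ae_eq {Ω : Set Plane} (hΩ : IsOpen Ω) {s : Plane → ℝ}
    {H H' : Plane → Mat2} (h : HasWeakHessian Ω s H) (h' : HasWeakHessian Ω s H') :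
    H =ᵐ[volume.restrict Ω] H' := by
  obtain ⟨g, hg, hH⟩ := h
  obtain ⟨g', hg', hH'⟩ := h'
  have key : ∀ i j, ∀ᵐ x ∂volume.restrict Ω, H x i j = H' x i j := fun i j =>
    (hH i j).ae_eq hΩ ((hH' i j).congr ((hg' i).ae_eq hΩ (hg i)) EventuallyEq.rfl)
  filter_upwards [key 0 0, key 0 1, key 1 0, key 1 1] with x h1 h2 h3 h4
  ext i j
  fin_cases i <;> fin_cases j <;> assumption

theorem HasWeakHessian.congr {Ω : Set Plane} {s s' : Plane → ℝ} {H H' : Plane → Mat2}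
    (h : HasWeakHessian Ω s H) (hs : s =ᵐ[volume.restrict Ω] s')
    (hH : H =ᵐ[volume.restrict Ω] H') : HasWeakHessian Ω s' H' := by
  obtain ⟨g, hg, hg'⟩ := h
  refine ⟨g, fun i => (hg i).congr hs EventuallyEq.rfl, fun i j => (hg' i j).congr
    EventuallyEq.rfl ?_⟩
  filter_upwards [hH] with x hx
  rw [hx]

theorem HasWeakHessian.symm_ae {Ω : Set Plane} (hΩ : IsOpen Ω) {s : Plane → ℝ}
    {H : Plane → Mat2} (h : HasWeakHessian Ω s H) :
    ∀ᵐ x ∂volume.restrict Ω, H x 0 1 = H x 1 0 := by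
  obtain ⟨g, hg, hg'⟩ := h
  exact (hg' 0 1).ae_eq hΩ (hg.hasWeakPartial_comm (hg' 1 0))

theorem mollify_const {Ω : Set Plane} {n : ℕ} {x : Plane} (c : ℝ)
    (hx : closedBall x (bumpSeq n).rOut ⊆ Ω) : mollify Ω n (fun _ => c) x = c := by
  have hx0 : x ∈ Ω := hx (mem_closedBall_self (bumpSeq n).rOut_pos.le)
  have := (bumpSeq n).normed_convolution_eq_right (μ := volume) (x₀ := x)
    (g := Ω.indicator fun _ => c) (fun y hy => by
      rw [indicator_of_mem (hx (ball_subset_closedBall hy)), indicator_of_mem hx0])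
  rw [indicator_of_mem hx0] at this
  exact this

/-- A function with constant weak gradient is almost everywhere affine. -/
theorem HasWeakGradient.ae_eq_affine {Ω : Set Plane} (hΩ : IsOpen Ω) (hc : Convex ℝ Ω)
    {w : Plane → ℝ} (hw : IntegrableOn w Ω) {c : Fin 2 → ℝ}
    (h : HasWeakGradient Ω w fun _ => c) :
    ∃ b, w =ᵐ[volume.restrict Ω] fun x => b + (x 0 * c 0 + x 1 * c 1) := by
  have hm := hΩ.measurableSet
  by_cases hne : volume.restrict Ω = 0
  · exact ⟨0, by rw [hne]; simp [Filter.EventuallyEq]⟩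
  have : NeBot (ae (volume.restrict Ω)) := ae_neBot.2 hne
  have hconv := mollify_tendsto_ae hm hw
  -- The additive constant is read off at one point `y` of convergence; such a point exists because
  -- `Ω` is not null.
  obtain ⟨y, hy, hyΩ⟩ := (hconv.and (ae_restrict_mem hm)).exists
  refine ⟨w y - (y 0 * c 0 + y 1 * c 1), ?_⟩
  filter_upwards [hconv, ae_restrict_mem hm] with x hx hxΩ
  have hev : ∀ᶠ n in atTop, mollify Ω n w x - mollify Ω n w y =
      (x 0 * c 0 + x 1 * c 1) - (y 0 * c 0 + y 1 * c 1) := by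
    filter_upwards [eventually_closedBall_bumpSeq_subset hΩ hxΩ,
      eventually_closedBall_bumpSeq_subset hΩ hyΩ] with n hxn hyn
    -- On this convex set the mollification has the constant gradient `c`, so subtracting `ℓ` leaves
    -- a function with zero derivative, which the mean value inequality shows to be constant.
    set E : Set Plane := {z | closedBall z (bumpSeq n).rOut ⊆ Ω}
    have hE : Convex ℝ E := fun p hp q hq a b ha hb hab =>
      closedBall_subset_of_segment hc hp hq ha hb hab
    let ℓ : Plane →L[ℝ] ℝ := c 0 • EuclideanSpace.proj 0 + c 1 • EuclideanSpace.proj 1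
    have hℓ : ∀ z : Plane, ℓ z = z 0 * c 0 + z 1 * c 1 := fun z => by simp [ℓ]; ring
    have hd : ∀ z ∈ E, HasFDerivWithinAt (fun z => mollify Ω n w z - ℓ z) (0 : Plane →L[ℝ] ℝ) E z := by
      intro z hz
      have h1 := ((mollify_contDiff hm hw n).differentiable (by simp) z).hasFDerivAt
      have h2 := (h1.sub ℓ.hasFDerivAt).hasFDerivWithinAt (s := E)
      convert! h2 using 1
      ext v
      have e0 := (h 0).partialDeriv_mollify hm hw hz
      have e1 := (h 1).partialDeriv_mollify hm hw hz
      rw [mollify_const _ hz] at e0 e1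
      simp [fderiv_apply_eq_sum_partialDeriv, e0, e1, hℓ]
    have := hE.norm_image_sub_le_of_norm_hasFDerivWithin_le (C := 0) hd (by simp) hyn hxn
    rw [zero_mul] at this
    have := norm_le_zero_iff.1 this
    rw [hℓ, hℓ] at this
    linarith
  have := tendsto_nhds_unique_of_eventuallyEq (hx.sub hy) tendsto_const_nhds hev
  linarith

/-! ### Convexity and positive semidefinite Hessians -/

/-- The points whose closed ball of the `n`-th mollification radius lies in `Ω`. -/
def innerPoints (Ω : Set Plane) (n : ℕ) : Set Plane := {x | closedBall x (bumpSeq n).rOut ⊆ Ω}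

theorem convex_innerPoints {Ω : Set Plane} (hc : Convex ℝ Ω) (n : ℕ) :
    Convex ℝ (innerPoints Ω n) :=
  fun _ hp _ hq _ _ ha hb hab => closedBall_subset_of_segment hc hp hq ha hb hab

theorem eventually_mem_innerPoints_of_mem_ball {Ω : Set Plane} {x : Plane} {r : ℝ}
    (hr : 0 < r) (hx : closedBall x (2 * r) ⊆ Ω) :
    ∀ᶠ n in atTop, ∀ y ∈ ball x r, y ∈ innerPoints Ω n := by
  filter_upwards [tendsto_bumpSeq_rOut.eventually (gt_mem_nhds hr)] with n hn y hy
  refine (closedBall_subset_closedBall' ?_).trans hx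
  have := mem_ball.1 hy
  linarith

theorem exists_closedBall_two_mul_subset {Ω : Set Plane} (hΩ : IsOpen Ω) {x : Plane}
    (hx : x ∈ Ω) : ∃ r > 0, closedBall x (2 * r) ⊆ Ω := by
  obtain ⟨ε, hε, h⟩ := Metric.isOpen_iff.1 hΩ x hx
  exact ⟨ε / 4, by positivity, (closedBall_subset_ball (by linarith)).trans h⟩

theorem integrable_mollifier_mul_indicator {Ω : Set Plane} (hΩ : MeasurableSet Ω)
    {u : Plane → ℝ} (hu : IntegrableOn u Ω) (n : ℕ) (x : Plane) :
    Integrable fun t => mollifier n t * Ω.indicator u (x - t) :=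
  (mollifier_hasCompactSupport n).convolutionExists_left (ContinuousLinearMap.lsmul ℝ ℝ)
    (mollifier_contDiff n).continuous (hu.integrable_indicator hΩ).locallyIntegrable x

theorem mollify_eq_integral (Ω : Set Plane) (u : Plane → ℝ) (n : ℕ) (x : Plane) :
    mollify Ω n u x = ∫ t, mollifier n t * Ω.indicator u (x - t) := rfl

theorem mollify_add {Ω : Set Plane} (hΩ : MeasurableSet Ω) {u v : Plane → ℝ}
    (hu : IntegrableOn u Ω) (hv : IntegrableOn v Ω) (n : ℕ) (x : Plane) :
    mollify Ω n (fun y => u y + v y) x = mollify Ω n u x + mollify Ω n v x := by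
  simp only [mollify_eq_integral]
  rw [← integral_add (integrable_mollifier_mul_indicator hΩ hu n x)
    (integrable_mollifier_mul_indicator hΩ hv n x)]
  congr 1
  ext t
  by_cases h : x - t ∈ Ω <;> simp [h, mul_add]

theorem mollify_const_mul (Ω : Set Plane) (c : ℝ) (u : Plane → ℝ) (n : ℕ) (x : Plane) :
    mollify Ω n (fun y => c * u y) x = c * mollify Ω n u x := by
  simp only [mollify_eq_integral]
  rw [← integral_const_mul]
  congr 1
  ext t
  by_cases h : x - t ∈ Ω <;> simp [h, mul_left_comm]

theorem mollify_nonneg {Ω : Set Plane} (hΩ : MeasurableSet Ω) {u : Plane → ℝ}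
    (hu : ∀ᵐ x ∂volume.restrict Ω, 0 ≤ u x) (n : ℕ) (x : Plane) : 0 ≤ mollify Ω n u x := by
  rw [mollify_apply hΩ]
  refine integral_nonneg_of_ae ?_
  filter_upwards [hu] with y hy
  exact mul_nonneg (mollifier_nonneg n _) hy

/-- The mollification is an average, with nonnegative weights, of translates of `s`. For points of
`innerPoints Ω n`, every translate with nonzero weight is evaluated inside `Ω`. -/
theorem convexOn_mollify {Ω : Set Plane} (hΩ : MeasurableSet Ω) {s : Plane → ℝ}
    (hs : ConvexOn ℝ Ω s) (hi : IntegrableOn s Ω) (n : ℕ) :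
    ConvexOn ℝ (innerPoints Ω n) (mollify Ω n s) := by
  refine ⟨convex_innerPoints hs.1 n, fun x hx y hy a b ha hb hab => ?_⟩
  simp only [mollify_eq_integral, smul_eq_mul]
  have hix := integrable_mollifier_mul_indicator hΩ hi n x
  have hiy := integrable_mollifier_mul_indicator hΩ hi n y
  rw [← integral_const_mul, ← integral_const_mul,
    ← integral_add (hix.const_mul a) (hiy.const_mul b)]
  refine integral_mono (integrable_mollifier_mul_indicator hΩ hi n _)
    ((hix.const_mul a).add (hiy.const_mul b)) fun t => ?_
  by_cases ht : t ∈ ball (0 : Plane) (bumpSeq n).rOut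
  · have hmem : ∀ z ∈ innerPoints Ω n, z - t ∈ Ω := fun z hz => hz (by
      rw [mem_closedBall, dist_eq_norm]
      simpa using (mem_ball_zero_iff.1 ht).le)
    have e : a • x + b • y - t = a • (x - t) + b • (y - t) := by
      have : a • (x - t) + b • (y - t) = a • x + b • y - (a + b) • t := by module
      rw [this, hab, one_smul]
    have h1 := hs.2 (hmem x hx) (hmem y hy) ha hb hab
    have h2 : a • x + b • y - t ∈ Ω := by
      rw [e]; exact hs.1 (hmem x hx) (hmem y hy) ha hb hab
    simp only [indicator_of_mem (hmem x hx), indicator_of_mem (hmem y hy), indicator_of_mem h2]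
    rw [e]
    have := mul_le_mul_of_nonneg_left h1 (mollifier_nonneg n t)
    simp only [smul_eq_mul] at this
    linarith
  · have : mollifier n t = 0 := by
      have h := (bumpSeq n).support_normed_eq (μ := volume)
      by_contra h'
      exact ht (h ▸ (h' : t ∈ Function.support ((bumpSeq n).normed volume)))
    simp [this]

theorem HasWeakGradient.hasDerivAt_mollify_line {Ω : Set Plane} (hΩ : MeasurableSet Ω)
    {u : Plane → ℝ} {g : Plane → Fin 2 → ℝ} (h : HasWeakGradient Ω u g) (hu : IntegrableOn u Ω)
    {n : ℕ} {x v : Plane} {t : ℝ} (hz : x + t • v ∈ innerPoints Ω n) :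
    HasDerivAt (fun t : ℝ => mollify Ω n u (x + t • v))
      (v 0 * mollify Ω n (fun y => g y 0) (x + t • v) +
        v 1 * mollify Ω n (fun y => g y 1) (x + t • v)) t := by
  have h1 := ((mollify_contDiff hΩ hu n).differentiable (by simp) (x + t • v)).hasFDerivAt
  have h2 : HasDerivAt (fun t : ℝ => x + t • v) v t := by
    simpa using ((hasDerivAt_id t).smul_const v).const_add x
  have h3 := h1.comp_hasDerivAt t h2
  rw [fderiv_apply_eq_sum_partialDeriv, (h 0).partialDeriv_mollify hΩ hu hz,
    (h 1).partialDeriv_mollify hΩ hu hz] at h3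
  exact h3

/-- The quadratic form of a matrix evaluated at a vector of the plane. -/
def quadForm (M : Mat2) (v : Plane) : ℝ :=
  v 0 * (v 0 * M 0 0 + v 1 * M 0 1) + v 1 * (v 0 * M 1 0 + v 1 * M 1 1)

/-- The entrywise mollification of a matrix field. -/
noncomputable def mollifyMat (Ω : Set Plane) (n : ℕ) (H : Plane → Mat2) (x : Plane) : Mat2 :=
  fun i j => mollify Ω n (fun y => H y i j) x

/-- For fixed `v` the quadratic form is linear in the matrix, so it commutes with the averaging. -/
theorem quadForm_mollifyMat_nonneg {Ω : Set Plane} (hΩ : MeasurableSet Ω) {H : Plane → Mat2}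
    (hH : ∀ i j, IntegrableOn (fun x => H x i j) Ω)
    (hpos : ∀ᵐ x ∂volume.restrict Ω, ∀ v, 0 ≤ quadForm (H x) v) (n : ℕ) (x v : Plane) :
    0 ≤ quadForm (mollifyMat Ω n H x) v := by
  have h := mollify_nonneg hΩ (hpos.mono fun _ hy => hy v) n x
  have i0 : ∀ i, IntegrableOn (fun y => v 0 * H y i 0 + v 1 * H y i 1) Ω := fun i =>
    ((hH i 0).const_mul _).add ((hH i 1).const_mul _)
  have e : ∀ i, mollify Ω n (fun y => v 0 * H y i 0 + v 1 * H y i 1) x =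
      v 0 * mollifyMat Ω n H x i 0 + v 1 * mollifyMat Ω n H x i 1 := fun i => by
    rw [mollify_add hΩ ((hH i 0).const_mul _) ((hH i 1).const_mul _), mollify_const_mul,
      mollify_const_mul]
    rfl
  simp only [quadForm] at h
  rw [mollify_add hΩ ((i0 0).const_mul _) ((i0 1).const_mul _), mollify_const_mul,
    mollify_const_mul, e, e] at h
  exact h

section Hessian

variable {Ω : Set Plane} {s : Plane → ℝ} {g : Plane → Fin 2 → ℝ} {H : Plane → Mat2}

theorem hasDerivAt_mollify_line_gradient (hΩ : MeasurableSet Ω)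
    (hH : ∀ i, HasWeakGradient Ω (fun x => g x i) (fun x => H x i))
    (hgi : ∀ i, IntegrableOn (fun x => g x i) Ω) {n : ℕ} {x v : Plane} {t : ℝ}
    (hz : x + t • v ∈ innerPoints Ω n) :
    HasDerivAt (fun t : ℝ => v 0 * mollify Ω n (fun y => g y 0) (x + t • v) +
        v 1 * mollify Ω n (fun y => g y 1) (x + t • v))
      (quadForm (mollifyMat Ω n H (x + t • v)) v) t :=
  (((hH 0).hasDerivAt_mollify_line hΩ (hgi 0) hz).const_mul _).add
    (((hH 1).hasDerivAt_mollify_line hΩ (hgi 1) hz).const_mul _)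

/-- The weak Hessian of a convex function is positive semidefinite. -/
theorem ConvexOn.quadForm_nonneg_ae (hΩ : IsOpen Ω) (hs : ConvexOn ℝ Ω s)
    (hg : HasWeakGradient Ω s g)
    (hH : ∀ i, HasWeakGradient Ω (fun x => g x i) (fun x => H x i))
    (hsi : IntegrableOn s Ω) (hgi : ∀ i, IntegrableOn (fun x => g x i) Ω)
    (hHi : ∀ i j, IntegrableOn (fun x => H x i j) Ω) :
    ∀ᵐ x ∂volume.restrict Ω, ∀ v, 0 ≤ quadForm (H x) v := by
  have hm := hΩ.measurableSet
  filter_upwards [mollify_tendsto_ae hm (hHi 0 0), mollify_tendsto_ae hm (hHi 0 1),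
    mollify_tendsto_ae hm (hHi 1 0), mollify_tendsto_ae hm (hHi 1 1), ae_restrict_mem hm]
    with x h00 h01 h10 h11 hx v
  obtain ⟨r, hr, hball⟩ := exists_closedBall_two_mul_subset hΩ hx
  have hlim : Tendsto (fun n => quadForm (mollifyMat Ω n H x) v) atTop (𝓝 (quadForm (H x) v)) :=
    (((h00.const_mul _).add (h01.const_mul _)).const_mul _).add
      (((h10.const_mul _).add (h11.const_mul _)).const_mul _)
  refine ge_of_tendsto hlim ?_
  filter_upwards [eventually_mem_innerPoints_of_mem_ball hr hball] with n hn
  -- Restricted to the line through `x` in direction `v`, the mollification is a convex function of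
  -- one variable. Its derivative is monotone, so its second derivative at `0`, which is the
  -- mollified quadratic form, is nonnegative.
  set T : Set ℝ := (fun t : ℝ => x + t • v) ⁻¹' ball x r with hT
  have hTo : IsOpen T := isOpen_ball.preimage (by fun_prop)
  have h0T : (0 : ℝ) ∈ T := by simp [hT, hr]
  have hTE : ∀ t ∈ T, x + t • v ∈ innerPoints Ω n := fun t ht => hn _ ht
  have hTc : Convex ℝ T := by
    have : T = (AffineMap.lineMap x (x + v) : ℝ →ᵃ[ℝ] Plane) ⁻¹' ball x r := by
      ext t
      simp [hT, AffineMap.lineMap_apply, add_comm]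
    rw [this]
    exact (convex_ball x r).affine_preimage _
  have hconv : ConvexOn ℝ T (fun t : ℝ => mollify Ω n s (x + t • v)) := by
    refine ⟨hTc, fun t ht t' ht' a b ha hb hab => ?_⟩
    have := (convexOn_mollify hm hs hsi n).2 (hTE t ht) (hTE t' ht') ha hb hab
    convert this using 2
    have : a • (x + t • v) + b • (x + t' • v) = (a + b) • x + (a * t + b * t') • v := by module
    rw [this, hab, one_smul]
    rfl
  have hd : ∀ t ∈ T, HasDerivAt (fun t : ℝ => mollify Ω n s (x + t • v)) _ t :=
    fun t ht => hg.hasDerivAt_mollify_line hm hsi (hTE t ht)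
  have hmono := hconv.monotoneOn_deriv fun t ht => (hd t ht).differentiableAt
  have hmono' := hmono.congr fun t ht => (hd t ht).deriv
  have hacc : AccPt (0 : ℝ) (𝓟 T) := (hTo.uniqueDiffOn (𝕜 := ℝ) 0 h0T).accPt
  have := (hasDerivAt_mollify_line_gradient hm hH hgi (hTE 0 h0T)).hasDerivWithinAt (s := T)
    |>.nonneg_of_monotoneOn hacc hmono'
  simpa using this

/-- Convexity is tested on segments, where the second derivative is the mollified quadratic form and
hence nonnegative. -/
theorem convexOn_mollify_of_quadForm_nonneg (hΩ : MeasurableSet Ω) (hc : Convex ℝ Ω)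
    (hg : HasWeakGradient Ω s g)
    (hH : ∀ i, HasWeakGradient Ω (fun x => g x i) (fun x => H x i))
    (hsi : IntegrableOn s Ω) (hgi : ∀ i, IntegrableOn (fun x => g x i) Ω)
    (hHi : ∀ i j, IntegrableOn (fun x => H x i j) Ω)
    (hpos : ∀ᵐ x ∂volume.restrict Ω, ∀ v, 0 ≤ quadForm (H x) v) (n : ℕ) :
    ConvexOn ℝ (innerPoints Ω n) (mollify Ω n s) := by
  refine ⟨convex_innerPoints hc n, fun x hx y hy a b ha hb hab => ?_⟩
  set v := y - x with hv
  have hE : ∀ t ∈ Icc (0 : ℝ) 1, x + t • v ∈ innerPoints Ω n := fun t ht => by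
    have := convex_innerPoints hc n hx hy (sub_nonneg.2 ht.2) ht.1 (by ring)
    convert! this using 1
    rw [hv]; module
  have hd : ∀ t ∈ Icc (0 : ℝ) 1, HasDerivAt (fun t : ℝ => mollify Ω n s (x + t • v)) _ t :=
    fun t ht => hg.hasDerivAt_mollify_line hΩ hsi (hE t ht)
  have hconv : ConvexOn ℝ (Icc (0 : ℝ) 1) (fun t : ℝ => mollify Ω n s (x + t • v)) :=
    convexOn_of_hasDerivWithinAt2_nonneg (convex_Icc 0 1)
      (fun t ht => (hd t ht).continuousAt.continuousWithinAt)
      (fun t ht => (hd t (interior_subset ht)).hasDerivWithinAt)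
      (fun t ht => (hasDerivAt_mollify_line_gradient hΩ hH hgi
        (hE t (interior_subset ht))).hasDerivWithinAt)
      (fun t _ => quadForm_mollifyMat_nonneg hΩ hHi hpos n _ v)
  have := hconv.2 (show (0 : ℝ) ∈ Icc (0 : ℝ) 1 by simp) (show (1 : ℝ) ∈ Icc (0 : ℝ) 1 by simp)
    ha hb hab
  have e : a • x + b • y = x + b • v := by
    rw [hv, ← eq_sub_iff_add_eq.2 hab |>.symm]; module
  simpa [e, hv] using this

/-- Convexity bounds the value at `x` by the mean of the values at `x + z` and `x - z`; integrate
this over the ball of `z`. The bound does not depend on `n`, which is what the limit needs. -/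
theorem mollify_le_of_convexOn (hΩ : MeasurableSet Ω) (hsi : IntegrableOn s Ω) {n : ℕ}
    (hconv : ConvexOn ℝ (innerPoints Ω n) (mollify Ω n s)) {x : Plane} {r : ℝ} (hr : 0 < r)
    (hx : ∀ y ∈ ball x r, y ∈ innerPoints Ω n) :
    mollify Ω n s x ≤ (volume.real (ball (0 : Plane) r))⁻¹ * ∫ y in Ω, ‖s y‖ := by
  set f := mollify Ω n s
  have hf : Integrable f := mollify_integrable hΩ hsi n
  have hV : 0 < volume.real (ball (0 : Plane) r) :=
    ENNReal.toReal_pos (measure_ball_pos volume _ hr).ne' measure_ball_lt_top.ne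
  have hadd : Integrable fun z => ‖f (x + z)‖ := hf.norm.comp_add_left x
  have hsub : Integrable fun z => ‖f (x - z)‖ := hf.norm.comp_sub_left x
  have key : ∫ _ in ball (0 : Plane) r, f x ≤
      ∫ z in ball (0 : Plane) r, (1 / 2 * ‖f (x + z)‖ + 1 / 2 * ‖f (x - z)‖) := by
    refine setIntegral_mono_on (integrableOn_const measure_ball_lt_top.ne)
      ((hadd.const_mul _).add (hsub.const_mul _)).integrableOn measurableSet_ball fun z hz => ?_
    have hz' := mem_ball_zero_iff.1 hz
    have := hconv.2 (hx (x + z) (by simpa using hz')) (hx (x - z) (by simpa using hz'))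
      (show (0 : ℝ) ≤ 1 / 2 by norm_num) (show (0 : ℝ) ≤ 1 / 2 by norm_num) (by norm_num)
    have e : (1 / 2 : ℝ) • (x + z) + (1 / 2 : ℝ) • (x - z) = x := by module
    rw [e] at this
    refine this.trans (add_le_add ?_ ?_) <;>
      exact mul_le_mul_of_nonneg_left (Real.le_norm_self _) (by norm_num)
  have key2 : ∫ z in ball (0 : Plane) r, (1 / 2 * ‖f (x + z)‖ + 1 / 2 * ‖f (x - z)‖) ≤
      ∫ y, ‖f y‖ := by
    have hI : Integrable fun z => 1 / 2 * ‖f (x + z)‖ + 1 / 2 * ‖f (x - z)‖ :=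
      (hadd.const_mul _).add (hsub.const_mul _)
    refine (setIntegral_le_integral hI
      (Eventually.of_forall fun z => ?_)).trans (le_of_eq ?_)
    · simp only [Pi.zero_apply]; positivity
    rw [integral_add (hadd.const_mul _) (hsub.const_mul _), integral_const_mul,
      integral_const_mul, integral_add_left_eq_self (fun y => ‖f y‖) x,
      integral_sub_left_eq_self (fun y => ‖f y‖) volume x]
    ring
  rw [setIntegral_const, smul_eq_mul] at key
  rw [← div_eq_inv_mul, le_div_iff₀' hV]
  exact key.trans (key2.trans (integral_norm_mollify_le hΩ hsi n))

/-- A function with positive semidefinite weak Hessian agrees almost everywhere with a convex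
function. -/
theorem exists_convexOn_ae_eq (hΩ : IsOpen Ω) (hc : Convex ℝ Ω) (hg : HasWeakGradient Ω s g)
    (hH : ∀ i, HasWeakGradient Ω (fun x => g x i) (fun x => H x i))
    (hsi : IntegrableOn s Ω) (hgi : ∀ i, IntegrableOn (fun x => g x i) Ω)
    (hHi : ∀ i j, IntegrableOn (fun x => H x i j) Ω)
    (hpos : ∀ᵐ x ∂volume.restrict Ω, ∀ v, 0 ≤ quadForm (H x) v) :
    ∃ f, ConvexOn ℝ Ω f ∧ s =ᵐ[volume.restrict Ω] f := by
  have hm := hΩ.measurableSet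
  have hconv := convexOn_mollify_of_quadForm_nonneg hm hc hg hH hsi hgi hHi hpos
  have hlim := mollify_tendsto_ae hm hsi
  have hev : ∀ x ∈ Ω, ∀ᶠ n in atTop, x ∈ innerPoints Ω n := fun x hx =>
    eventually_closedBall_bumpSeq_subset hΩ hx
  have hup : ∀ x ∈ Ω, ∃ C, ∀ᶠ n in atTop, mollify Ω n s x ≤ C := fun x hx => by
    obtain ⟨r, hr, hball⟩ := exists_closedBall_two_mul_subset hΩ hx
    refine ⟨_, (eventually_mem_innerPoints_of_mem_ball hr hball).mono fun n hn =>
      mollify_le_of_convexOn hm hsi (hconv n) hr hn⟩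
  -- Choose `y` near `x` where the mollifications converge and reflect `x` through it. Since `y` is
  -- the midpoint of `x` and `2y - x`, the upper bound at `2y - x` and convergence at `y` bound the
  -- values at `x` from below.
  have hlow : ∀ x ∈ Ω, ∃ c, ∀ᶠ n in atTop, c ≤ mollify Ω n s x := fun x hx => by
    set A : Set Plane := Ω ∩ (fun y => (2 : ℝ) • y - x) ⁻¹' Ω with hA
    have hAo : IsOpen A := hΩ.inter (hΩ.preimage (by fun_prop))
    have hxA : x ∈ A := ⟨hx, by
      have : (2 : ℝ) • x - x = x := by module
      simpa [this] using hx⟩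
    have hfreq := frequently_ae_mem_iff.2 (hAo.measure_pos volume ⟨x, hxA⟩).ne'
    obtain ⟨y, hyA, hy⟩ := (hfreq.and_eventually ((ae_restrict_iff' hm).1 hlim)).exists
    obtain ⟨C, hC⟩ := hup _ hyA.2
    refine ⟨2 * (s y - 1) - C, ?_⟩
    filter_upwards [hC, (hy hyA.1).eventually (lt_mem_nhds (sub_one_lt (s y))), hev x hx,
      hev _ hyA.2] with n h1 h2 h3 h4
    have h5 := (hconv n).2 h3 h4
      (show (0 : ℝ) ≤ 1 / 2 by norm_num) (show (0 : ℝ) ≤ 1 / 2 by norm_num) (by norm_num)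
    have e : (1 / 2 : ℝ) • x + (1 / 2 : ℝ) • ((2 : ℝ) • y - x) = y := by module
    rw [e] at h5
    simp only [smul_eq_mul] at h5
    linarith
  have hbdd : ∀ x ∈ Ω, IsBoundedUnder (· ≤ ·) atTop fun n => mollify Ω n s x := fun x hx => by
    obtain ⟨C, hC⟩ := hup x hx
    exact isBoundedUnder_of_eventually_le hC
  have hcob : ∀ x ∈ Ω, IsCoboundedUnder (· ≤ ·) atTop fun n => mollify Ω n s x := fun x hx => by
    obtain ⟨C, hC⟩ := hlow x hx
    exact (isBoundedUnder_of_eventually_ge hC).isCoboundedUnder_le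
  -- The limsup is defined at every point, inherits convexity, and equals `s` wherever the
  -- mollifications converge. The two-sided bounds make it meaningful in `ℝ`.
  refine ⟨fun x => limsup (fun n => mollify Ω n s x) atTop, ⟨hc, ?_⟩, ?_⟩
  · intro x hx y hy a b ha hb hab
    refine le_of_forall_pos_le_add fun ε hε => ?_
    refine limsup_le_of_le (hcob _ (hc hx hy ha hb hab)) ?_
    filter_upwards [eventually_lt_of_limsup_lt (lt_add_of_pos_right _ hε) (hbdd x hx),
      eventually_lt_of_limsup_lt (lt_add_of_pos_right _ hε) (hbdd y hy), hev x hx, hev y hy]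
      with n h1 h2 h3 h4
    have h5 := (hconv n).2 h3 h4 ha hb hab
    simp only [smul_eq_mul] at h5 ⊢
    have e : b = 1 - a := by linarith
    subst e
    nlinarith [mul_le_mul_of_nonneg_left h1.le ha, mul_le_mul_of_nonneg_left h2.le hb]
  · filter_upwards [hlim] with x hx
    exact hx.limsup_eq.symm

end Hessian

/-! ### Integrals along segments -/

theorem lintegral_comp_smul_add_le {u : Plane → ℝ≥0∞} (hu : Measurable u) {t : ℝ}
    (ht : 1 / 2 ≤ t) (b : Plane) : ∫⁻ x, u (t • x + b) ≤ 4 * ∫⁻ x, u x := by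
  have ht0 : 0 < t := by linarith
  have hm : Measurable fun x : Plane => u (x + b) := hu.comp (measurable_id.add_const b)
  have e1 : ∫⁻ x, u (t • x + b) = ∫⁻ x, u (x + b) ∂(Measure.map (t • ·) (volume : Measure Plane)) :=
    (lintegral_map hm (measurable_const_smul t)).symm
  rw [e1, Measure.map_addHaar_smul volume ht0.ne', lintegral_smul_measure,
    lintegral_add_right_eq_self u b, smul_eq_mul]
  gcongr
  rw [finrank_euclideanSpace_fin, abs_of_nonneg (by positivity)]
  have : (t ^ 2)⁻¹ ≤ 4 := by
    rw [inv_le_comm₀ (by positivity) (by norm_num)]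
    nlinarith
  calc ENNReal.ofReal (t ^ 2)⁻¹ ≤ ENNReal.ofReal 4 := ENNReal.ofReal_le_ofReal this
    _ = 4 := by simp

/-- Averages along segments are controlled by the `L¹` norm. -/
theorem lintegral_segment_le {u : Plane → ℝ≥0∞} (hu : Measurable u) (X A : Set Plane) :
    ∫⁻ p, u (p.1.2 + p.2 • (p.1.1 - p.1.2))
        ∂(((volume.restrict X).prod (volume.restrict A)).prod (volume.restrict (Ioc (0 : ℝ) 1))) ≤
      4 * (volume A + volume X) * ∫⁻ x, u x := by
  have hmeas : Measurable fun p : (Plane × Plane) × ℝ => u (p.1.2 + p.2 • (p.1.1 - p.1.2)) :=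
    hu.comp (by fun_prop)
  rw [lintegral_prod_symm _ hmeas.aemeasurable]
  have key : ∀ t ∈ Ioc (0 : ℝ) 1, ∫⁻ q, u (q.2 + t • (q.1 - q.2))
      ∂((volume.restrict X).prod (volume.restrict A)) ≤
        4 * (volume A + volume X) * ∫⁻ x, u x := by
    intro t ht
    have hmt : Measurable fun q : Plane × Plane => u (q.2 + t • (q.1 - q.2)) :=
      hu.comp (by fun_prop)
    -- The point on the segment is `t x + (1 - t) a`, and one of the two coefficients is at least
    -- `1/2`. Integrating first over that endpoint keeps the planar Jacobian factor at most `4`,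
    -- with no singularity at either end.
    rcases le_total (1 / 2) t with h | h
    · rw [lintegral_prod_symm _ hmt.aemeasurable]
      calc _ ≤ ∫⁻ _ in A, 4 * ∫⁻ x, u x := by
            refine lintegral_mono fun a => (setLIntegral_le_lintegral _ _).trans ?_
            have : ∀ x : Plane, a + t • (x - a) = t • x + (a - t • a) := fun x => by module
            simp only [this]
            exact lintegral_comp_smul_add_le hu h _
        _ = 4 * volume A * ∫⁻ x, u x := by
            rw [setLIntegral_const]; ring
        _ ≤ _ := by gcongr; exact le_self_add
    · rw [lintegral_prod _ hmt.aemeasurable]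
      calc _ ≤ ∫⁻ _ in X, 4 * ∫⁻ x, u x := by
            refine lintegral_mono fun x => (setLIntegral_le_lintegral _ _).trans ?_
            have : ∀ a : Plane, a + t • (x - a) = (1 - t) • a + t • x := fun a => by module
            simp only [this]
            exact lintegral_comp_smul_add_le hu (by linarith) _
        _ = 4 * volume X * ∫⁻ x, u x := by
            rw [setLIntegral_const]; ring
        _ ≤ _ := by gcongr; exact le_add_self
  calc _ ≤ ∫⁻ _ in Ioc (0 : ℝ) 1, 4 * (volume A + volume X) * ∫⁻ x, u x :=
        setLIntegral_mono measurable_const key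
    _ = _ := by simp

/-- The integral of the `i`-th component `u dxᵢ` of a one-form along the segment from `q.2` to
`q.1`. -/
noncomputable def segmentIntegral (i : Fin 2) (u : Plane → ℝ) (q : Plane × Plane) : ℝ :=
  ∫ t in Ioc (0 : ℝ) 1, u (q.2 + t • (q.1 - q.2)) * (q.1 - q.2) i

section Segment

variable {X A : Set Plane} {D : ℝ} {u : Plane → ℝ} {i : Fin 2}

theorem lintegral_segment_mul_le (hX : MeasurableSet X) (hA : MeasurableSet A)
    (hD : ∀ x ∈ X, ∀ a ∈ A, ‖x - a‖ ≤ D) (hu : Measurable u) :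
    ∫⁻ p, ‖u (p.1.2 + p.2 • (p.1.1 - p.1.2)) * (p.1.1 - p.1.2) i‖ₑ
        ∂(((volume.restrict X).prod (volume.restrict A)).prod (volume.restrict (Ioc (0 : ℝ) 1))) ≤
      ENNReal.ofReal D * (4 * (volume A + volume X) * ∫⁻ x, ‖u x‖ₑ) := by
  have hm : Measurable fun x => ‖u x‖ₑ := hu.enorm
  refine le_trans ?_ (mul_le_mul_right (lintegral_segment_le hm X A) _)
  have hm' : Measurable fun p : (Plane × Plane) × ℝ =>
      ‖u (p.1.2 + p.2 • (p.1.1 - p.1.2))‖ₑ := hm.comp (by fun_prop)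
  rw [← lintegral_const_mul _ hm']
  refine lintegral_mono_ae ?_
  have hae : ∀ᵐ q ∂((volume.restrict X).prod (volume.restrict A)), q ∈ X ×ˢ A := by
    rw [Measure.prod_restrict]
    exact ae_restrict_mem (hX.prod hA)
  have hae' := Measure.quasiMeasurePreserving_fst (μ := (volume.restrict X).prod (volume.restrict A))
    (ν := volume.restrict (Ioc (0 : ℝ) 1)) |>.ae hae
  filter_upwards [hae'] with p hp
  rw [enorm_mul, mul_comm]
  gcongr
  rw [← ofReal_norm]
  exact ENNReal.ofReal_le_ofReal ((PiLp.norm_apply_le _ i).trans (hD _ hp.1 _ hp.2))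

theorem integrable_segment_mul (hX : MeasurableSet X) (hA : MeasurableSet A)
    (hXf : volume X ≠ ⊤) (hAf : volume A ≠ ⊤)
    (hD : ∀ x ∈ X, ∀ a ∈ A, ‖x - a‖ ≤ D) (hu : Measurable u) (hi : Integrable u) :
    Integrable (fun p : (Plane × Plane) × ℝ =>
        u (p.1.2 + p.2 • (p.1.1 - p.1.2)) * (p.1.1 - p.1.2) i)
      (((volume.restrict X).prod (volume.restrict A)).prod (volume.restrict (Ioc (0 : ℝ) 1))) := by
  refine ⟨((hu.comp (by fun_prop)).mul (by fun_prop)).aestronglyMeasurable, ?_⟩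
  refine (lintegral_segment_mul_le hX hA hD hu).trans_lt ?_
  refine ENNReal.mul_lt_top ENNReal.ofReal_lt_top (ENNReal.mul_lt_top ?_ hi.2)
  exact ENNReal.mul_lt_top (by simp) (ENNReal.add_lt_top.2 ⟨hAf.lt_top, hXf.lt_top⟩)

theorem integrable_segmentIntegral (hX : MeasurableSet X) (hA : MeasurableSet A)
    (hXf : volume X ≠ ⊤) (hAf : volume A ≠ ⊤)
    (hD : ∀ x ∈ X, ∀ a ∈ A, ‖x - a‖ ≤ D) (hu : Measurable u) (hi : Integrable u) :
    Integrable (segmentIntegral i u) ((volume.restrict X).prod (volume.restrict A)) :=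
  (integrable_segment_mul hX hA hXf hAf hD hu hi).integral_prod_left

theorem integral_norm_segmentIntegral_le (hX : MeasurableSet X) (hA : MeasurableSet A)
    (hXf : volume X ≠ ⊤) (hAf : volume A ≠ ⊤) (hD0 : 0 ≤ D)
    (hD : ∀ x ∈ X, ∀ a ∈ A, ‖x - a‖ ≤ D) (hu : Measurable u) (hi : Integrable u) :
    ∫ q, ‖segmentIntegral i u q‖ ∂((volume.restrict X).prod (volume.restrict A)) ≤
      D * (4 * (volume.real A + volume.real X)) * ∫ x, ‖u x‖ := by
  have h := integrable_segment_mul (i := i) hX hA hXf hAf hD hu hi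
  calc _ ≤ ∫ q, (∫ t in Ioc (0 : ℝ) 1, ‖u (q.2 + t • (q.1 - q.2)) * (q.1 - q.2) i‖)
        ∂((volume.restrict X).prod (volume.restrict A)) :=
        integral_mono_of_nonneg (Eventually.of_forall fun _ => norm_nonneg _)
          h.norm.integral_prod_left (Eventually.of_forall fun _ => norm_integral_le_integral_norm _)
    _ = ∫ p, ‖u (p.1.2 + p.2 • (p.1.1 - p.1.2)) * (p.1.1 - p.1.2) i‖
        ∂(((volume.restrict X).prod (volume.restrict A)).prod
          (volume.restrict (Ioc (0 : ℝ) 1))) := (integral_prod _ h.norm).symm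
    _ ≤ _ := by
      rw [integral_norm_eq_lintegral_enorm h.1, integral_norm_eq_lintegral_enorm hi.1]
      have hle := lintegral_segment_mul_le (i := i) hX hA hD hu
      have hfin : ENNReal.ofReal D * (4 * (volume A + volume X) * ∫⁻ x, ‖u x‖ₑ) ≠ ⊤ :=
        (ENNReal.mul_lt_top ENNReal.ofReal_lt_top (ENNReal.mul_lt_top (ENNReal.mul_lt_top (by simp)
          (ENNReal.add_lt_top.2 ⟨hAf.lt_top, hXf.lt_top⟩)) hi.2)).ne
      refine (ENNReal.toReal_mono hfin hle).trans (le_of_eq ?_)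
      rw [ENNReal.toReal_mul, ENNReal.toReal_mul, ENNReal.toReal_mul,
        ENNReal.toReal_add hAf hXf, ENNReal.toReal_ofReal hD0]
      simp only [measureReal_def, ENNReal.toReal_ofNat]
      ring

/-- Linearity needs both integrals along the segment to converge, which Fubini gives only for almost
every pair of endpoints. -/
theorem segmentIntegral_sub_ae (hX : MeasurableSet X) (hA : MeasurableSet A)
    (hXf : volume X ≠ ⊤) (hAf : volume A ≠ ⊤)
    (hD : ∀ x ∈ X, ∀ a ∈ A, ‖x - a‖ ≤ D) (hu : Measurable u) (hi : Integrable u)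
    {v : Plane → ℝ} (hv : Measurable v) (hvi : Integrable v) :
    ∀ᵐ q ∂((volume.restrict X).prod (volume.restrict A)),
      segmentIntegral i (u - v) q = segmentIntegral i u q - segmentIntegral i v q := by
  filter_upwards [(integrable_segment_mul (i := i) hX hA hXf hAf hD hu hi).prod_right_ae,
    (integrable_segment_mul (i := i) hX hA hXf hAf hD hv hvi).prod_right_ae] with q h1 h2
  rw [segmentIntegral, segmentIntegral, segmentIntegral, ← integral_sub h1 h2]
  congr 1
  ext t
  simp [sub_mul]

/-- The `L¹` bound on segment integrals, applied to `v n - u`, lets smooth fields approximate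
integrable ones in the weak formulation. -/
theorem tendsto_integral_segmentIntegral_mul (hX : MeasurableSet X) (hA : MeasurableSet A)
    (hXf : volume X ≠ ⊤) (hAf : volume A ≠ ⊤) (hD0 : 0 ≤ D)
    (hD : ∀ x ∈ X, ∀ a ∈ A, ‖x - a‖ ≤ D) (hu : Measurable u) (hi : Integrable u)
    {v : ℕ → Plane → ℝ} (hv : ∀ n, Measurable (v n)) (hvi : ∀ n, Integrable (v n))
    (hlim : Tendsto (fun n => ∫ x, ‖v n x - u x‖) atTop (𝓝 0))
    {ψ : Plane → ℝ} (hψ : Continuous ψ) {M : ℝ} (hM : ∀ x, ‖ψ x‖ ≤ M) :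
    Tendsto (fun n => ∫ q, segmentIntegral i (v n) q * ψ q.1
        ∂((volume.restrict X).prod (volume.restrict A))) atTop
      (𝓝 (∫ q, segmentIntegral i u q * ψ q.1
        ∂((volume.restrict X).prod (volume.restrict A)))) := by
  have hM0 : 0 ≤ M := (norm_nonneg _).trans (hM 0)
  have hint : ∀ w : Plane → ℝ, Measurable w → Integrable w →
      Integrable (fun q => segmentIntegral i w q * ψ q.1)
        ((volume.restrict X).prod (volume.restrict A)) := fun w hw hwi =>
    (integrable_segmentIntegral hX hA hXf hAf hD hw hwi).mul_bdd (c := M)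
      (by fun_prop) (Eventually.of_forall fun q => hM q.1)
  rw [tendsto_iff_norm_sub_tendsto_zero]
  set C := D * (4 * (volume.real A + volume.real X)) with hC
  refine squeeze_zero (fun _ => norm_nonneg _) (g := fun n => M * (C * ∫ x, ‖v n x - u x‖))
    (fun n => ?_) ?_
  · rw [← integral_sub (hint _ (hv n) (hvi n)) (hint _ hu hi)]
    have hd := integrable_segmentIntegral (i := i) hX hA hXf hAf hD ((hv n).sub hu) ((hvi n).sub hi)
    calc _ ≤ ∫ q, M * ‖segmentIntegral i (v n - u) q‖
          ∂((volume.restrict X).prod (volume.restrict A)) := by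
          refine norm_integral_le_of_norm_le (hd.norm.const_mul M) ?_
          filter_upwards [segmentIntegral_sub_ae (i := i) hX hA hXf hAf hD (hv n) (hvi n) hu hi]
            with q hq
          rw [← sub_mul, ← hq, norm_mul, mul_comm]
          exact mul_le_mul_of_nonneg_right (hM _) (norm_nonneg _)
      _ ≤ _ := by
          rw [integral_const_mul]
          exact mul_le_mul_of_nonneg_left (integral_norm_segmentIntegral_le hX hA hXf hAf hD0 hD
            ((hv n).sub hu) ((hvi n).sub hi)) hM0
  · simpa using (hlim.const_mul C).const_mul M

end Segment

/-! ### The Poincaré lemma -/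

theorem partialDeriv_eq_zero_of_notMem_tsupport {φ : Plane → ℝ} {x : Plane} (i : Fin 2)
    (hx : x ∉ tsupport φ) : partialDeriv i φ x = 0 :=
  image_eq_zero_of_notMem_tsupport fun h => hx (tsupport_fderiv_apply_subset ℝ _ h)

/-- Integration by parts against a test function supported where `h` is differentiable with
continuous partial derivative. -/
theorem integral_mul_partialDeriv_testFunction {U : Set Plane} {φ : Plane → ℝ}
    (hφ : IsTestFunction U φ) (j : Fin 2) {h h' : Plane → ℝ}
    (hd : ∀ x ∈ U, DifferentiableAt ℝ h x) (hh' : ∀ x ∈ U, partialDeriv j h x = h' x)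
    (hc : ContinuousOn h' U) :
    ∫ x, h x * partialDeriv j φ x = -∫ x, h' x * φ x := by
  have hi : ∀ {f ψ : Plane → ℝ}, ContinuousOn f U → Continuous ψ →
      (∀ x, x ∉ tsupport φ → ψ x = 0) → Integrable fun x => f x * ψ x := by
    intro f ψ hf hψ h0
    refine IntegrableOn.integrable_of_forall_notMem_eq_zero (s := tsupport φ) ?_ fun x hx => by
      rw [h0 x hx, mul_zero]
    exact ((hf.mono hφ.tsupport_subset).mul hψ.continuousOn).integrableOn_compact
      hφ.hasCompactSupport
  have hhc : ContinuousOn h U := fun x hx => (hd x hx).continuousAt.continuousWithinAt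
  have e : ∀ x, fderiv ℝ h x (EuclideanSpace.single j 1) * φ x = h' x * φ x := fun x => by
    by_cases hx : x ∈ tsupport φ
    · rw [← hh' x (hφ.tsupport_subset hx)]; rfl
    · rw [image_eq_zero_of_notMem_tsupport hx, mul_zero, mul_zero]
  have key := integral_mul_fderiv_eq_neg_fderiv_mul_of_integrable (μ := (volume : Measure Plane))
    (f := h) (g := φ) (v := EuclideanSpace.single j 1) (𝕜 := ℝ)
    (by simp only [e]; exact hi hc hφ.smooth.continuous fun x => image_eq_zero_of_notMem_tsupport)
    (hi hhc (hφ.partialDeriv j).smooth.continuous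
      fun x hx => partialDeriv_eq_zero_of_notMem_tsupport j hx)
    (hi hhc hφ.smooth.continuous fun x => image_eq_zero_of_notMem_tsupport)
    (fun x hx => hd x (hφ.tsupport_subset hx))
    (fun x _ => hφ.smooth.differentiable (by simp) x)
  simp only [e] at key
  exact key

/-- The segment integrals of a smooth one-form that is closed on a convex open set `U` provide
a primitive on `U`. -/
theorem integral_segmentIntegral_mul_partialDeriv {U : Set Plane} (hU : IsOpen U)
    (hc : Convex ℝ U) {u : Fin 2 → Plane → ℝ} (hu : ∀ i, ContDiff ℝ ∞ (u i))
    (hcurl : ∀ x ∈ U, partialDeriv 1 (u 0) x = partialDeriv 0 (u 1) x) {a : Plane} (ha : a ∈ U)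
    {φ : Plane → ℝ} (hφ : IsTestFunction U φ) (j : Fin 2) :
    ∫ x, (segmentIntegral 0 (u 0) (x, a) + segmentIntegral 1 (u 1) (x, a)) * partialDeriv j φ x =
      -∫ x, u j x * φ x := by
  let W : Plane → Plane →L[ℝ] ℝ := fun x =>
    u 0 x • EuclideanSpace.proj 0 + u 1 x • EuclideanSpace.proj 1
  have hW : ∀ x v, W x v = u 0 x * v 0 + u 1 x * v 1 := fun x v => by simp [W]
  have hdu : ∀ i x, HasFDerivAt (u i) (fderiv ℝ (u i) x) x := fun i x =>
    ((hu i).differentiable (by simp) x).hasFDerivAt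
  have hWd : ∀ x, HasFDerivAt W ((fderiv ℝ (u 0) x).smulRight (EuclideanSpace.proj 0) +
      (fderiv ℝ (u 1) x).smulRight (EuclideanSpace.proj 1)) x := fun x =>
    ((hdu 0 x).smul_const (EuclideanSpace.proj 0 : Plane →L[ℝ] ℝ)).add
      ((hdu 1 x).smul_const (EuclideanSpace.proj 1 : Plane →L[ℝ] ℝ))
  -- Symmetry of the derivative of `W` is precisely the curl condition, so the classical Poincaré
  -- lemma gives a primitive `h`. The segment integrals then equal `h x - h a` by the fundamental
  -- theorem of calculus.
  obtain ⟨h, hh⟩ := hc.exists_forall_hasFDerivAt_of_fderiv_symmetric hU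
    (fun x _ => (hWd x).differentiableAt.differentiableWithinAt) (fun x hx v w => by
      rw [(hWd x).fderiv]
      have hp : ∀ i (v : Plane), (EuclideanSpace.proj i : Plane →L[ℝ] ℝ) v = v i := fun _ _ => rfl
      simp only [add_apply, smul_apply, ContinuousLinearMap.smulRight_apply, hp, smul_eq_mul,
        fderiv_apply_eq_sum_partialDeriv, hcurl x hx]
      ring)
  have hseg : ∀ x ∈ U, segmentIntegral 0 (u 0) (x, a) + segmentIntegral 1 (u 1) (x, a) =
      h x - h a := by
    intro x hx
    have hd : ∀ t ∈ uIcc (0 : ℝ) 1, HasDerivAt (fun t : ℝ => h (a + t • (x - a)))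
        (W (a + t • (x - a)) (x - a)) t := fun t ht => by
      rw [uIcc_of_le zero_le_one] at ht
      have hm : a + t • (x - a) ∈ U := hc.add_smul_sub_mem ha hx ht
      have h2 : HasDerivAt (fun t : ℝ => a + t • (x - a)) (x - a) t := by
        simpa using ((hasDerivAt_id t).smul_const (x - a)).const_add a
      exact (hh _ hm).comp_hasDerivAt t h2
    have hcont : ∀ i, Continuous fun t : ℝ => u i (a + t • (x - a)) * (x - a) i := fun i =>
      ((hu i).continuous.comp (by fun_prop)).mul continuous_const
    simp only [hW] at hd
    have := intervalIntegral.integral_eq_sub_of_hasDerivAt hd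
      (((hcont 0).add (hcont 1)).intervalIntegrable 0 1)
    rw [intervalIntegral.integral_add ((hcont 0).intervalIntegrable 0 1)
      ((hcont 1).intervalIntegrable 0 1), intervalIntegral.integral_of_le zero_le_one,
      intervalIntegral.integral_of_le zero_le_one] at this
    simpa [segmentIntegral] using this
  have e : ∀ x, (segmentIntegral 0 (u 0) (x, a) + segmentIntegral 1 (u 1) (x, a)) *
      partialDeriv j φ x = (h x - h a) * partialDeriv j φ x := fun x => by
    by_cases hx : x ∈ tsupport φ
    · rw [hseg x (hφ.tsupport_subset hx)]
    · rw [partialDeriv_eq_zero_of_notMem_tsupport j hx, mul_zero, mul_zero]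
  simp only [e]
  refine integral_mul_partialDeriv_testFunction hφ j (h := fun x => h x - h a)
    (fun x hx => ((hh x hx).sub_const _).differentiableAt) (fun x hx => ?_)
    (hu j).continuous.continuousOn
  rw [partialDeriv, ((hh x hx).sub_const _).fderiv, hW]
  fin_cases j <;> simp

theorem segmentIntegral_indicator {Ω U : Set Plane} (hc : Convex ℝ U) (hUΩ : U ⊆ Ω)
    (u : Plane → ℝ) (i : Fin 2) {x a : Plane} (hx : x ∈ U) (ha : a ∈ U) :
    segmentIntegral i (Ω.indicator u) (x, a) = segmentIntegral i u (x, a) := by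
  refine setIntegral_congr_fun measurableSet_Ioc fun t ht => ?_
  have : a + t • (x - a) ∈ Ω := hUΩ (hc.add_smul_sub_mem ha hx ⟨ht.1.le, ht.2⟩)
  simp [this]

/-- The support of a test function and a ball contained in `Ω` have a common convex open
neighbourhood that stays away from the boundary of `Ω`. -/
theorem IsTestFunction.exists_convex_nhds {Ω : Set Plane} (hΩ : IsOpen Ω) (hc : Convex ℝ Ω)
    {φ : Plane → ℝ} (hφ : IsTestFunction Ω φ) {a : Plane} {r : ℝ} (ha : closedBall a r ⊆ Ω) :
    ∃ U, IsOpen U ∧ Convex ℝ U ∧ U ⊆ Ω ∧ closedBall a r ⊆ U ∧ IsTestFunction U φ ∧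
      ∀ᶠ n in atTop, U ⊆ innerPoints Ω n := by
  set K := tsupport φ ∪ closedBall a r with hK
  have hKc : IsCompact K := IsCompact.union hφ.hasCompactSupport (isCompact_closedBall a r)
  obtain ⟨δ, hδ, hδΩ⟩ := hKc.exists_cthickening_subset_open hΩ (union_subset hφ.tsupport_subset ha)
  set E : Set Plane := {x | closedBall x (δ / 2) ⊆ Ω} with hE
  have hEc : Convex ℝ E := fun _ hp _ hq _ _ ha hb hab =>
    closedBall_subset_of_segment hc hp hq ha hb hab
  have hKE : K ⊆ interior E := fun y hy => by
    refine mem_interior.2 ⟨ball y (δ / 2), fun x hx w hw => hδΩ (thickening_subset_cthickening δ K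
      (mem_thickening_iff.2 ⟨y, hy, ?_⟩)), isOpen_ball, mem_ball_self (by positivity)⟩
    linarith [dist_triangle w x y, mem_ball.1 hx, mem_closedBall.1 hw]
  refine ⟨interior E, isOpen_interior, hEc.interior,
    fun x hx => interior_subset hx (mem_closedBall_self (by positivity)),
    subset_union_right.trans hKE,
    ⟨hφ.smooth, hφ.hasCompactSupport, subset_union_left.trans hKE⟩, ?_⟩
  filter_upwards [tendsto_bumpSeq_rOut.eventually (gt_mem_nhds (half_pos hδ))] with n hn z hz
  have hz' : z ∈ E := interior_subset hz
  exact (closedBall_subset_closedBall hn.le).trans hz'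

/-- The Poincaré lemma for integrable vector fields on bounded convex planar domains. -/
theorem IsCurlFree.exists_hasWeakGradient {Ω : Set Plane} (hΩ : IsOpen Ω) (hc : Convex ℝ Ω)
    (hb : Bornology.IsBounded Ω) {F : Plane → Fin 2 → ℝ}
    (hF : ∀ i, IntegrableOn (fun x => F x i) Ω) (hcurl : IsCurlFree Ω F) :
    ∃ f, IntegrableOn f Ω ∧ HasWeakGradient Ω f F := by
  have hm := hΩ.measurableSet
  rcases Ω.eq_empty_or_nonempty with rfl | ⟨a₀, ha₀⟩
  · refine ⟨0, by simp, fun i => ⟨?_, ?_, fun φ _ => by simp⟩⟩ <;> intro x hx <;>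
      exact absurd hx (notMem_empty x)
  obtain ⟨r, hr, hball⟩ := exists_closedBall_two_mul_subset hΩ ha₀
  have hrΩ : closedBall a₀ r ⊆ Ω := (closedBall_subset_closedBall (by linarith)).trans hball
  set B := ball a₀ r with hB
  have hBm : MeasurableSet B := measurableSet_ball
  have hBΩ : B ⊆ Ω := ball_subset_closedBall.trans hrΩ
  obtain ⟨D, hD⟩ : ∃ D, ∀ x ∈ Ω, ∀ a ∈ B, ‖x - a‖ ≤ D := by
    obtain ⟨D, hD⟩ := Metric.isBounded_iff.1 hb
    exact ⟨D, fun x hx a ha => by rw [← dist_eq_norm]; exact hD hx (hBΩ ha)⟩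
  have hD0 : 0 ≤ D := (norm_nonneg _).trans (hD a₀ ha₀ a₀ (mem_ball_self hr))
  have hΩf : volume Ω ≠ ⊤ := hb.measure_lt_top.ne
  have hBf : volume B ≠ ⊤ := measure_ball_lt_top.ne
  have : IsFiniteMeasure (volume.restrict Ω) := ⟨by simpa using hb.measure_lt_top⟩
  have : IsFiniteMeasure (volume.restrict B) := ⟨by simpa using hBf.lt_top⟩
  have hV : 0 < volume.real B :=
    ENNReal.toReal_pos (measure_ball_pos volume _ hr).ne' measure_ball_lt_top.ne
  -- The segment estimates require Borel measurable functions integrable on the whole plane, so each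
  -- component is replaced by such a representative vanishing off `Ω`.
  have hrep : ∀ i, ∃ G : Plane → ℝ, Measurable G ∧ Integrable G ∧
      (∀ᵐ x ∂volume.restrict Ω, G x = F x i) ∧ ∀ x, x ∉ Ω → G x = 0 := fun i => by
    have hae := (hF i).aestronglyMeasurable.ae_eq_mk
    set G' := (hF i).aestronglyMeasurable.mk (fun x => F x i)
    have hG' : Measurable G' := (hF i).aestronglyMeasurable.stronglyMeasurable_mk.measurable
    refine ⟨Ω.indicator G', hG'.indicator hm,
      (integrable_indicator_iff hm).2 ((integrable_congr hae).1 (hF i)), ?_,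
      fun x hx => indicator_of_notMem hx _⟩
    filter_upwards [hae, ae_restrict_mem hm] with x hx hxΩ
    rw [indicator_of_mem hxΩ, hx]
  choose G hGm hGi hGF hG0 using hrep
  set u : ℕ → Fin 2 → Plane → ℝ := fun n i => mollify Ω n fun x => F x i with hu
  have hus : ∀ n i, ContDiff ℝ ∞ (u n i) := fun n i => mollify_contDiff hm (hF i) n
  have hwm : ∀ n i, Measurable (Ω.indicator (u n i)) := fun n i =>
    (hus n i).continuous.measurable.indicator hm
  have hwi : ∀ n i, Integrable (Ω.indicator (u n i)) := fun n i =>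
    (mollify_integrable hm (hF i) n).indicator hm
  have hwlim : ∀ i, Tendsto (fun n => ∫ x, ‖Ω.indicator (u n i) x - G i x‖) atTop (𝓝 0) := by
    intro i
    refine (mollify_tendsto_integral_norm hm hb (hF i)).congr fun n => ?_
    have e : ∫ x in Ω, ‖Ω.indicator (u n i) x - G i x‖ = ∫ x, ‖Ω.indicator (u n i) x - G i x‖ :=
      setIntegral_eq_integral_of_forall_compl_eq_zero fun x hx => by simp [hx, hG0 i x hx]
    rw [← e]
    refine integral_congr_ae ?_
    filter_upwards [hGF i, ae_restrict_mem hm] with x hx hxΩ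
    rw [indicator_of_mem hxΩ, hx]
  have hsegi : ∀ i (w : Plane → ℝ), Measurable w → Integrable w →
      Integrable (segmentIntegral i w) ((volume.restrict Ω).prod (volume.restrict B)) :=
    fun i w hw hwi => integrable_segmentIntegral hm hBm hΩf hBf hD hw hwi
  set J : Plane × Plane → ℝ := fun q => segmentIntegral 0 (G 0) q + segmentIntegral 1 (G 1) q
  have hJ : Integrable J ((volume.restrict Ω).prod (volume.restrict B)) :=
    (hsegi 0 _ (hGm 0) (hGi 0)).add (hsegi 1 _ (hGm 1) (hGi 1))
  set f : Plane → ℝ := fun x => (volume.real B)⁻¹ * ∫ a in B, J (x, a) with hf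
  have hfi : IntegrableOn f Ω := hJ.integral_prod_left.const_mul _
  refine ⟨f, hfi, fun j => ⟨hfi.locallyIntegrableOn, (hF j).locallyIntegrableOn, fun φ hφ => ?_⟩⟩
  have bdd : ∀ {ψ : Plane → ℝ}, IsTestFunction Ω ψ → ∃ M, ∀ x, ‖ψ x‖ ≤ M := fun hψ =>
    hψ.smooth.continuous.bounded_above_of_compact_support hψ.hasCompactSupport
  have hψ := hφ.partialDeriv j
  obtain ⟨M, hM⟩ := bdd hψ
  obtain ⟨M', hM'⟩ := bdd hφ
  have hmulψ : ∀ i (w : Plane → ℝ), Measurable w → Integrable w →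
      Integrable (fun q : Plane × Plane => segmentIntegral i w q * partialDeriv j φ q.1)
        ((volume.restrict Ω).prod (volume.restrict B)) := fun i w hw hwi =>
    (hsegi i w hw hwi).mul_bdd (c := M) (hψ.smooth.continuous.comp continuous_fst).aestronglyMeasurable
      (Eventually.of_forall fun q => hM q.1)
  have lim1 := (tendsto_integral_segmentIntegral_mul (i := 0) hm hBm hΩf hBf hD0 hD (hGm 0) (hGi 0)
    (fun n => hwm n 0) (fun n => hwi n 0) (hwlim 0) hψ.smooth.continuous hM).add
    (tendsto_integral_segmentIntegral_mul (i := 1) hm hBm hΩf hBf hD0 hD (hGm 1) (hGi 1)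
    (fun n => hwm n 1) (fun n => hwi n 1) (hwlim 1) hψ.smooth.continuous hM)
  have lim2 : Tendsto (fun n => ∫ x in Ω, u n j x * φ x) atTop (𝓝 (∫ x in Ω, F x j * φ x)) := by
    rw [tendsto_iff_norm_sub_tendsto_zero]
    refine squeeze_zero (fun _ => norm_nonneg _)
      (g := fun n => M' * ∫ x in Ω, ‖u n j x - F x j‖) (fun n => ?_) ?_
    · have hui : IntegrableOn (u n j) Ω := (mollify_integrable hm (hF j) n).integrableOn
      rw [← integral_sub
        (LocallyIntegrableOn.integrableOn_mul_testFunction hui.locallyIntegrableOn hφ)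
        (LocallyIntegrableOn.integrableOn_mul_testFunction (hF j).locallyIntegrableOn hφ),
        ← integral_const_mul]
      refine norm_integral_le_of_norm_le ((hui.sub (hF j)).norm.const_mul M')
        (Eventually.of_forall fun x => ?_)
      rw [← sub_mul, norm_mul, mul_comm]
      exact mul_le_mul_of_nonneg_right (hM' x) (norm_nonneg _)
    · simpa using (mollify_tendsto_integral_norm hm hb (hF j)).const_mul M'
  obtain ⟨U, hUo, hUc, hUΩ, hBU, hφU, hUn⟩ := hφ.exists_convex_nhds hΩ hc hrΩ
  -- Once `U` lies in `innerPoints Ω n`, the mollified form is closed on `U` and the smooth identity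
  -- holds for each base point `a ∈ B`. Its right side does not involve `a`, so integration over `B`
  -- only adds the factor `volume.real B`.
  have hev : ∀ᶠ n in atTop,
      (∫ q, segmentIntegral 0 (Ω.indicator (u n 0)) q * partialDeriv j φ q.1
        ∂((volume.restrict Ω).prod (volume.restrict B))) +
      (∫ q, segmentIntegral 1 (Ω.indicator (u n 1)) q * partialDeriv j φ q.1
        ∂((volume.restrict Ω).prod (volume.restrict B))) =
      -(volume.real B * ∫ x in Ω, u n j x * φ x) := by
    filter_upwards [hUn] with n hn
    have i0 := hmulψ 0 _ (hwm n 0) (hwi n 0)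
    have i1 := hmulψ 1 _ (hwm n 1) (hwi n 1)
    have i01 : Integrable (fun q : Plane × Plane =>
        segmentIntegral 0 (Ω.indicator (u n 0)) q * partialDeriv j φ q.1 +
        segmentIntegral 1 (Ω.indicator (u n 1)) q * partialDeriv j φ q.1)
        ((volume.restrict Ω).prod (volume.restrict B)) := i0.add i1
    rw [← integral_add i0 i1, integral_prod_symm _ i01]
    have inner : ∀ a ∈ B, ∫ x in Ω, (segmentIntegral 0 (Ω.indicator (u n 0)) (x, a) *
        partialDeriv j φ x + segmentIntegral 1 (Ω.indicator (u n 1)) (x, a) *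
        partialDeriv j φ x) = -∫ x in Ω, u n j x * φ x := by
      intro a ha
      have haU : a ∈ U := hBU (ball_subset_closedBall ha)
      have key := integral_segmentIntegral_mul_partialDeriv hUo hUc (u := u n) (hus n)
        (fun x hx => hcurl.partialDeriv_mollify hm hF (hn hx)) haU hφU j
      rw [setIntegral_eq_integral_of_forall_compl_eq_zero,
        setIntegral_eq_integral_of_forall_compl_eq_zero, ← key]
      · congr 1
        ext x
        by_cases hx : x ∈ tsupport φ
        · rw [segmentIntegral_indicator hUc hUΩ _ _ (hφU.tsupport_subset hx) haU,
            segmentIntegral_indicator hUc hUΩ _ _ (hφU.tsupport_subset hx) haU, add_mul]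
        · simp [partialDeriv_eq_zero_of_notMem_tsupport j hx]
      · intro x hx
        rw [image_eq_zero_of_notMem_tsupport fun h => hx (hφ.tsupport_subset h), mul_zero]
      · intro x hx
        simp [partialDeriv_eq_zero_of_notMem_tsupport j fun h => hx (hφ.tsupport_subset h)]
    rw [setIntegral_congr_fun hBm (g := fun _ => -∫ x in Ω, u n j x * φ x) inner,
      setIntegral_const, smul_eq_mul, mul_neg]
  have heq := tendsto_nhds_unique_of_eventuallyEq lim1 (lim2.const_mul (volume.real B)).neg hev
  have i0 := hmulψ 0 _ (hGm 0) (hGi 0)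
  have i1 := hmulψ 1 _ (hGm 1) (hGi 1)
  have i01 : Integrable (fun q : Plane × Plane => segmentIntegral 0 (G 0) q * partialDeriv j φ q.1 +
      segmentIntegral 1 (G 1) q * partialDeriv j φ q.1)
      ((volume.restrict Ω).prod (volume.restrict B)) := i0.add i1
  rw [← integral_add i0 i1, integral_prod _ i01] at heq
  have e1 : ∫ x in Ω, f x * partialDeriv j φ x =
      (volume.real B)⁻¹ * ∫ x in Ω, ∫ a in B, (segmentIntegral 0 (G 0) (x, a) *
        partialDeriv j φ x + segmentIntegral 1 (G 1) (x, a) * partialDeriv j φ x) := by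
    rw [← integral_const_mul]
    congr 1
    ext x
    simp only [← add_mul]
    rw [integral_mul_const, hf, mul_assoc]
  rw [e1]
  simp only [] at heq ⊢
  rw [heq, mul_neg, inv_mul_cancel_left₀ hV.ne']

/-! ### Weak Hessians modulo affine functions -/

theorem HasWeakGradient.isCurlFree {Ω : Set Plane} {u : Plane → ℝ} {g : Plane → Fin 2 → ℝ}
    (h : HasWeakGradient Ω u g) : IsCurlFree Ω g := fun φ hφ => by
  have e0 := (h 0).integral_eq _ (hφ.partialDeriv 1)
  have e1 := (h 1).integral_eq _ (hφ.partialDeriv 0)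
  simp only [hφ.partialDeriv_comm 0 1] at e0
  linarith

theorem ContDiff.hasWeakPartial {Ω : Set Plane} {u : Plane → ℝ} (hu : ContDiff ℝ ∞ u)
    (i : Fin 2) : HasWeakPartial Ω i u (partialDeriv i u) := by
  have hc : Continuous (partialDeriv i u) :=
    (hu.continuous_fderiv (by simp)).clm_apply continuous_const
  refine ⟨hu.continuous.locallyIntegrable.locallyIntegrableOn Ω,
    hc.locallyIntegrable.locallyIntegrableOn Ω, fun φ hφ => ?_⟩
  rw [setIntegral_eq_integral_of_forall_compl_eq_zero,
    setIntegral_eq_integral_of_forall_compl_eq_zero]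
  · exact integral_mul_partialDeriv_testFunction hφ i
      (fun x _ => hu.differentiable (by simp) x) (fun _ _ => rfl) hc.continuousOn
  · intro x hx
    rw [image_eq_zero_of_notMem_tsupport fun h => hx (hφ.tsupport_subset h), mul_zero]
  · intro x hx
    rw [partialDeriv_eq_zero_of_notMem_tsupport i fun h => hx (hφ.tsupport_subset h), mul_zero]

theorem hasWeakPartial_const (Ω : Set Plane) (i : Fin 2) (c : ℝ) :
    HasWeakPartial Ω i (fun _ => c) fun _ => 0 := by
  have : partialDeriv i (fun _ => c) = fun _ => 0 := by
    ext x; simp [partialDeriv]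
  exact this ▸ (contDiff_const (c := c)).hasWeakPartial i

theorem hasWeakPartial_affine (Ω : Set Plane) (i : Fin 2) (a : Plane →ᵃ[ℝ] ℝ) :
    HasWeakPartial Ω i a fun _ => a.linear (EuclideanSpace.single i 1) := by
  have e : (a : Plane → ℝ) = fun x => LinearMap.toContinuousLinearMap a.linear x + a 0 := by
    ext x
    have := congrFun a.decomp x
    simpa using this
  have hd : ∀ x, HasFDerivAt (a : Plane → ℝ) (LinearMap.toContinuousLinearMap a.linear) x :=
    fun x => by
      rw [e]
      exact (ContinuousLinearMap.hasFDerivAt _).add_const _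
  have hs : ContDiff ℝ ∞ (a : Plane → ℝ) := by
    rw [e]
    exact (ContinuousLinearMap.contDiff _).add contDiff_const
  have : partialDeriv i (a : Plane → ℝ) = fun _ => a.linear (EuclideanSpace.single i 1) := by
    ext x
    rw [partialDeriv, (hd x).fderiv]
    rfl
  exact this ▸ hs.hasWeakPartial i

/-- Subtracting an affine function does not change the weak Hessian. -/
theorem HasWeakHessian.of_sub_affine {Ω : Set Plane} (hΩ : MeasurableSet Ω) {s s' : Plane → ℝ}
    {H : Plane → Mat2} (h : HasWeakHessian Ω s H) {a : Plane →ᵃ[ℝ] ℝ}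
    (ha : ∀ x ∈ Ω, s x - s' x = a x) : HasWeakHessian Ω s' H := by
  obtain ⟨g, hg, hH⟩ := h
  refine ⟨fun x i => g x i - a.linear (EuclideanSpace.single i 1), fun i => ?_, fun i j => ?_⟩
  · refine ((hg i).sub (hasWeakPartial_affine Ω i a)).congr ?_ EventuallyEq.rfl
    filter_upwards [ae_restrict_mem hΩ] with x hx
    linarith [ha x hx]
  · simpa only [sub_zero] using (hH i j).sub (hasWeakPartial_const Ω j _)

theorem MemW21.integrable_of_hasWeakGradient {Ω : Set Plane} (hΩ : IsOpen Ω) {s : Plane → ℝ}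
    (h : MemW21 Ω s) {g : Plane → Fin 2 → ℝ} (hg : HasWeakGradient Ω s g) (i : Fin 2) :
    IntegrableOn (fun x => g x i) Ω := by
  obtain ⟨g', hg', hi⟩ := h.exists_gradient
  exact (integrable_congr ((hg' i).ae_eq hΩ (hg i))).1 (hi i)

theorem MemW21.integrable_of_hasWeakHessian {Ω : Set Plane} (hΩ : IsOpen Ω) {s : Plane → ℝ}
    (h : MemW21 Ω s) {H : Plane → Mat2} (hH : HasWeakHessian Ω s H) (i j : Fin 2) :
    IntegrableOn (fun x => H x i j) Ω := by
  obtain ⟨H', hH', hi⟩ := h.exists_hessian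
  refine (integrable_congr ?_).1 (hi i j)
  filter_upwards [hH'.ae_eq hΩ hH] with x hx
  rw [hx]

/-- Convex `W^{2,1}` functions with the same weak Hessian differ by an affine function. -/
theorem IsConvexPotential.exists_affine {Ω : Set Plane} (hΩ : IsOpen Ω) {s s' : Plane → ℝ}
    (hs : IsConvexPotential Ω s) (hs' : IsConvexPotential Ω s') {H : Plane → Mat2}
    (h : HasWeakHessian Ω s H) (h' : HasWeakHessian Ω s' H) :
    ∃ a : Plane →ᵃ[ℝ] ℝ, ∀ x ∈ Ω, s x - s' x = a x := by
  have hc := hs.convexOn.1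
  obtain ⟨g, hg, hH⟩ := h
  obtain ⟨g', hg', hH'⟩ := h'
  have hgi : ∀ i, IntegrableOn (fun x => g x i - g' x i) Ω := fun i =>
    (hs.memW21.integrable_of_hasWeakGradient hΩ hg i).sub
    (hs'.memW21.integrable_of_hasWeakGradient hΩ hg' i)
  have hconst : ∀ i, ∃ b, (fun x => g x i - g' x i) =ᵐ[volume.restrict Ω] fun _ => b := fun i => by
    have : HasWeakGradient Ω (fun x => g x i - g' x i) fun _ _ => 0 := fun j => by
      simpa only [sub_self] using (hH i j).sub (hH' i j)
    obtain ⟨b, hb⟩ := this.ae_eq_affine hΩ hc (hgi i)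
    exact ⟨b, by simpa using hb⟩
  choose b hb using hconst
  have hw : HasWeakGradient Ω (fun x => s x - s' x) fun _ => b := fun i =>
    ((hg i).sub (hg' i)).congr EventuallyEq.rfl (hb i)
  obtain ⟨d, hd⟩ := hw.ae_eq_affine hΩ hc (hs.memW21.integrable.sub hs'.memW21.integrable)
  let ℓ : Plane →L[ℝ] ℝ := b 0 • EuclideanSpace.proj 0 + b 1 • EuclideanSpace.proj 1
  have hℓ : ∀ x : Plane, ℓ x = x 0 * b 0 + x 1 * b 1 := fun x => by simp [ℓ]; ring
  -- The equivalence relation demands equality at every point of `Ω`; continuity of convex functions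
  -- on an open set upgrades the almost everywhere equality.
  have heq := Measure.eqOn_open_of_ae_eq hd hΩ
    ((hs.convexOn.continuousOn hΩ).sub (hs'.convexOn.continuousOn hΩ))
    (by fun_prop)
  refine ⟨ℓ.toLinearMap.toAffineMap + AffineMap.const ℝ Plane d, fun x hx => ?_⟩
  refine (heq hx).trans ?_
  simp [hℓ, add_comm]

/-! ### Conjugation by the rotation -/

theorem rotR_transpose_mul_self : rotRᵀ * rotR = 1 := by
  ext i j
  fin_cases i <;> fin_cases j <;> simp [rotR, Matrix.mul_apply, Fin.sum_univ_two]

theorem rotR_mul_transpose : rotR * rotRᵀ = 1 := by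
  ext i j
  fin_cases i <;> fin_cases j <;> simp [rotR, Matrix.mul_apply, Fin.sum_univ_two]

theorem rotR_conj_eq (M : Mat2) :
    rotRᵀ * M * rotR = !![M 1 1, -M 1 0; -M 0 1, M 0 0] := by
  ext i j
  fin_cases i <;> fin_cases j <;> simp [rotR, Matrix.mul_apply, Fin.sum_univ_two]

theorem rotR_conj_transpose_eq (M : Mat2) :
    rotR * M * rotRᵀ = !![M 1 1, -M 1 0; -M 0 1, M 0 0] := by
  ext i j
  fin_cases i <;> fin_cases j <;> simp [rotR, Matrix.mul_apply, Fin.sum_univ_two,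
    Matrix.vecMul, dotProduct]

theorem rotR_conj_rotR_conj_transpose (M : Mat2) : rotRᵀ * (rotR * M * rotRᵀ) * rotR = M := by
  have : rotRᵀ * (rotR * M * rotRᵀ) * rotR = (rotRᵀ * rotR) * M * (rotRᵀ * rotR) := by
    simp only [mul_assoc]
  rw [this, rotR_transpose_mul_self, one_mul, mul_one]

theorem rotR_conj_injective {M N : Mat2} (h : rotRᵀ * M * rotR = rotRᵀ * N * rotR) : M = N := by
  have key : ∀ M : Mat2, rotR * (rotRᵀ * M * rotR) * rotRᵀ = M := fun M => by
    have : rotR * (rotRᵀ * M * rotR) * rotRᵀ = (rotR * rotRᵀ) * M * (rotR * rotRᵀ) := by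
      simp only [mul_assoc]
    rw [this, rotR_mul_transpose, one_mul, mul_one]
  rw [← key M, h, key]

theorem det_rotR_conj (M : Mat2) : (rotRᵀ * M * rotR).det = M.det := by
  rw [rotR_conj_eq, Matrix.det_fin_two, Matrix.det_fin_two]
  simp; ring

theorem det_rotR_conj_transpose (M : Mat2) : (rotR * M * rotRᵀ).det = M.det := by
  rw [rotR_conj_transpose_eq, Matrix.det_fin_two, Matrix.det_fin_two]
  simp; ring

theorem quadForm_rotR_conj_nonneg {M : Mat2} (hM : M.PosDef) (v : Plane) :
    0 ≤ quadForm (rotRᵀ * M * rotR) v := by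
  have h := hM.posSemidef.dotProduct_mulVec_nonneg ![-v 1, v 0]
  rw [rotR_conj_eq]
  simp only [quadForm, star_trivial, dotProduct, Matrix.mulVec, Fin.sum_univ_two] at h ⊢
  simp at h ⊢
  linarith

/-- A zero entry `M 1 1` would force `det M ≤ 0`, so it is positive. Completing the square then
writes `M 1 1` times the rotated form as a square plus `det M * x 1 ^ 2`. -/
theorem posDef_rotR_conj_transpose {M : Mat2} (hs : M 0 1 = M 1 0)
    (hpos : ∀ v, 0 ≤ quadForm M v) (hdet : 0 < M.det) : (rotR * M * rotRᵀ).PosDef := by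
  rw [Matrix.det_fin_two, hs] at hdet
  have h1 : 0 ≤ M 1 1 := by simpa [quadForm] using hpos (EuclideanSpace.single 1 1)
  have h1' : 0 < M 1 1 := by
    rcases h1.lt_or_eq with h | h
    · exact h
    · rw [← h] at hdet; nlinarith [sq_nonneg (M 1 0)]
  rw [rotR_conj_transpose_eq]
  refine Matrix.PosDef.of_dotProduct_mulVec_pos ?_ fun x hx => ?_
  · ext i j
    fin_cases i <;> fin_cases j <;> simp [hs]
  · have hx' : x 0 ≠ 0 ∨ x 1 ≠ 0 := by
      by_contra! h
      exact hx (by ext i; fin_cases i; exacts [h.1, h.2])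
    simp only [star_trivial, dotProduct, Matrix.mulVec, Fin.sum_univ_two]
    simp only [Matrix.of_apply, Matrix.cons_val_zero, Matrix.cons_val_one, hs]
    have key : 0 < M 1 1 * (x 0 * (M 1 1 * x 0 + -M 1 0 * x 1) +
        x 1 * (-M 1 0 * x 0 + M 0 0 * x 1)) := by
      have e : M 1 1 * (x 0 * (M 1 1 * x 0 + -M 1 0 * x 1) +
        x 1 * (-M 1 0 * x 0 + M 0 0 * x 1)) =
        (M 1 1 * x 0 - M 1 0 * x 1) ^ 2 + (M 0 0 * M 1 1 - M 1 0 * M 1 0) * x 1 ^ 2 := by ring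
      rw [e]
      by_cases h : x 1 = 0
      · have h0 := hx'.resolve_right (not_not.2 h)
        rw [h]
        have : 0 < (M 1 1 * x 0) ^ 2 := by positivity
        nlinarith
      · have : 0 < (M 0 0 * M 1 1 - M 1 0 * M 1 0) * x 1 ^ 2 := by positivity
        nlinarith [sq_nonneg (M 1 1 * x 0 - M 1 0 * x 1)]
    exact pos_of_mul_pos_right key h1

/-! ### The correspondence between conductivities and potentials -/

/-- Up to sign and order, row `i` of the rotated matrix is a row of `Q`, which symmetry identifies
with a column. The curl identity is then the divergence identity with `l` a basis vector. -/
theorem IsDivFreeConductivity.isCurlFree_rotR_conj {Ω : Set Plane} {Q : Plane → Mat2}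
    (hQ : IsDivFreeConductivity Ω Q) (i : Fin 2) :
    IsCurlFree Ω fun x => (rotRᵀ * Q x * rotR) i := fun φ hφ => by
  have hsymm : ∀ᵐ x ∂volume.restrict Ω, Q x 0 1 = Q x 1 0 := by
    filter_upwards [hQ.posDef] with x hx
    simpa using hx.isHermitian.apply 1 0
  have hint : ∀ k l m, IntegrableOn (fun x => Q x k l * partialDeriv m φ x) Ω := fun k l m =>
    LocallyIntegrableOn.integrableOn_mul_testFunction (hQ.integrable k l).locallyIntegrableOn
      (hφ.partialDeriv m)
  have key : ∀ l, (∫ x in Ω, Q x 0 l * partialDeriv 0 φ x) +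
      ∫ x in Ω, Q x 1 l * partialDeriv 1 φ x = 0 := fun l => by
    rw [← integral_add (hint 0 l 0) (hint 1 l 1), ← hQ.divergenceFree φ hφ (Pi.single l 1)]
    congr 1
    ext x
    simp [dotProduct, Fin.sum_univ_two]
    ring
  have hswap : ∀ m, ∫ x in Ω, Q x 1 0 * partialDeriv m φ x =
      ∫ x in Ω, Q x 0 1 * partialDeriv m φ x := fun m =>
    integral_congr_ae (by filter_upwards [hsymm] with x hx; rw [hx])
  have k0 := key 0
  have k1 := key 1
  simp only [rotR_conj_eq]
  fin_cases i <;> simp [integral_neg]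
  · rw [hswap]; linarith
  · rw [← hswap]; linarith

theorem IsDivFreeConductivity.exists_potential {Ω : Set Plane} (hΩ : IsOpen Ω)
    (hc : Convex ℝ Ω) (hb : Bornology.IsBounded Ω) {Q : Plane → Mat2}
    (hQ : IsDivFreeConductivity Ω Q) :
    ∃ s, IsConvexPotential Ω s ∧ HasWeakHessian Ω s fun x => rotRᵀ * Q x * rotR := by
  have hHi : ∀ i j, IntegrableOn (fun x => (rotRᵀ * Q x * rotR) i j) Ω := fun i j => by
    simp only [rotR_conj_eq]
    fin_cases i <;> fin_cases j
    exacts [hQ.integrable 1 1, (hQ.integrable 1 0).neg, (hQ.integrable 0 1).neg, hQ.integrable 0 0]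
  have hsymm : ∀ᵐ x ∂volume.restrict Ω,
      (rotRᵀ * Q x * rotR) 1 0 = (rotRᵀ * Q x * rotR) 0 1 := by
    filter_upwards [hQ.posDef] with x hx
    simpa [rotR_conj_eq] using hx.isHermitian.apply 1 0
  choose g hgi hg using fun i =>
    (hQ.isCurlFree_rotR_conj i).exists_hasWeakGradient hΩ hc hb (hHi i)
  -- The curl of `(g 0, g 1)` is the difference of the off-diagonal entries of the rotated matrix,
  -- which vanishes by symmetry.
  obtain ⟨s, hsi, hs⟩ := IsCurlFree.exists_hasWeakGradient hΩ hc hb (F := fun x i => g i x) hgi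
    fun φ hφ => by
      rw [(hg 0 1).integral_eq φ hφ, (hg 1 0).integral_eq φ hφ]
      congr 1
      exact integral_congr_ae (by filter_upwards [hsymm] with x hx; rw [hx])
  have hpos : ∀ᵐ x ∂volume.restrict Ω, ∀ v, 0 ≤ quadForm (rotRᵀ * Q x * rotR) v :=
    hQ.posDef.mono fun x hx v => quadForm_rotR_conj_nonneg hx v
  obtain ⟨f, hf, hsf⟩ := exists_convexOn_ae_eq (H := fun x => rotRᵀ * Q x * rotR) hΩ hc hs hg hsi
    hgi hHi hpos
  have hH : HasWeakHessian Ω f fun x => rotRᵀ * Q x * rotR :=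
    HasWeakHessian.congr ⟨_, hs, hg⟩ hsf EventuallyEq.rfl
  refine ⟨f, ⟨hf, ⟨(integrable_congr hsf).1 hsi, ⟨_, fun i => (hs i).congr hsf EventuallyEq.rfl,
    hgi⟩, ⟨_, hH, hHi⟩⟩, ⟨_, hH, ?_⟩⟩, hH⟩
  simpa only [DetBounded, det_rotR_conj] using hQ.detBounded

theorem IsConvexPotential.exists_conductivity {Ω : Set Plane} (hΩ : IsOpen Ω) {s : Plane → ℝ}
    (hs : IsConvexPotential Ω s) :
    ∃ Q, IsDivFreeConductivity Ω Q ∧ HasWeakHessian Ω s fun x => rotRᵀ * Q x * rotR := by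
  obtain ⟨H, hH, hdet⟩ := hs.detBounded
  have hHi := hs.memW21.integrable_of_hasWeakHessian hΩ hH
  have hsymm := hH.symm_ae hΩ
  refine ⟨fun x => rotR * H x * rotRᵀ, ⟨fun i j => ?_, ?_, fun φ hφ l => ?_, ?_⟩, ?_⟩
  · simp only [rotR_conj_transpose_eq]
    fin_cases i <;> fin_cases j
    exacts [hHi 1 1, (hHi 1 0).neg, (hHi 0 1).neg, hHi 0 0]
  · obtain ⟨g, hg, hg'⟩ := hH
    obtain ⟨c, C, hc, hdet⟩ := hdet
    filter_upwards [hsymm, hdet, hs.convexOn.quadForm_nonneg_ae hΩ hg hg' hs.memW21.integrable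
      (hs.memW21.integrable_of_hasWeakGradient hΩ hg) hHi] with x h1 h2 h3
    exact posDef_rotR_conj_transpose h1 h3 (hc.trans_le h2.1)
  · obtain ⟨g, hg, hg'⟩ := hH
    have hint : ∀ k l m, IntegrableOn (fun x => H x k l * partialDeriv m φ x) Ω := fun k l m =>
      LocallyIntegrableOn.integrableOn_mul_testFunction (hHi k l).locallyIntegrableOn
        (hφ.partialDeriv m)
    have e : ∫ x in Ω, (fun i => partialDeriv i φ x) ⬝ᵥ ((rotR * H x * rotRᵀ) *ᵥ l) =
        ∫ x in Ω, (l 0 * (H x 1 1 * partialDeriv 0 φ x - H x 1 0 * partialDeriv 1 φ x) +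
          l 1 * (H x 0 0 * partialDeriv 1 φ x - H x 0 1 * partialDeriv 0 φ x)) := by
      refine integral_congr_ae ?_
      filter_upwards [hsymm] with x hx
      rw [rotR_conj_transpose_eq, hx]
      simp [dotProduct, Matrix.mulVec, Fin.sum_univ_two]
      ring
    have i1 : IntegrableOn (fun x => H x 1 1 * partialDeriv 0 φ x - H x 1 0 * partialDeriv 1 φ x)
      Ω := (hint 1 1 0).sub (hint 1 0 1)
    have i2 : IntegrableOn (fun x => H x 0 0 * partialDeriv 1 φ x - H x 0 1 * partialDeriv 0 φ x)
      Ω := (hint 0 0 1).sub (hint 0 1 0)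
    rw [e, integral_add (i1.const_mul _) (i2.const_mul _), integral_const_mul, integral_const_mul,
      integral_sub (hint 1 1 0) (hint 1 0 1), integral_sub (hint 0 0 1) (hint 0 1 0),
      (hg' 0).isCurlFree φ hφ, (hg' 1).isCurlFree φ hφ]
    ring
  · simpa only [DetBounded, det_rotR_conj_transpose] using hdet
  · simpa only [rotR_conj_rotR_conj_transpose] using hH

theorem mainTheorem2 (Ω : Set Plane) (hopen : IsOpen Ω) (hconvex : Convex ℝ Ω)
    (hbounded : Bornology.IsBounded Ω) :
    (∀ Q : DivFreeField Ω, ∃! S : ConvexClass Ω, ∃ s : ConvexPotential Ω,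
      Quotient.mk (convexPotentialSetoid Ω) s = S ∧
        HasWeakHessian Ω s.1 (fun x => rotRᵀ * Q.1 x * rotR)) ∧
    ∃ T : MDiv Ω → ConvexClass Ω, Function.Bijective T ∧
      ∀ (Q : DivFreeField Ω) (s : ConvexPotential Ω),
        T (Quotient.mk (divFreeSetoid Ω) Q) = Quotient.mk (convexPotentialSetoid Ω) s ↔
          HasWeakHessian Ω s.1 (fun x => rotRᵀ * Q.1 x * rotR) := by
  have hex : ∀ Q : DivFreeField Ω, ∃ s : ConvexPotential Ω,
      HasWeakHessian Ω s.1 fun x => rotRᵀ * Q.1 x * rotR := fun Q => by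
    obtain ⟨s, hs, hH⟩ := Q.2.exists_potential hopen hconvex hbounded
    exact ⟨⟨s, hs⟩, hH⟩
  refine ⟨fun Q => ?_, ?_⟩
  · obtain ⟨s, hs⟩ := hex Q
    refine ⟨_, ⟨s, rfl, hs⟩, ?_⟩
    rintro _ ⟨s', rfl, hs'⟩
    exact Quotient.sound (s'.2.exists_affine hopen s.2 hs' hs)
  · choose σ hσ using hex
    -- `T` uses an arbitrary representative; `hT` characterizes it by the Hessian equation for every
    -- representative, and injectivity and surjectivity follow from that characterization.
    set T : MDiv Ω → ConvexClass Ω := fun q => Quotient.mk (convexPotentialSetoid Ω) (σ q.out)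
    have hT : ∀ (Q : DivFreeField Ω) (s : ConvexPotential Ω),
        T (Quotient.mk (divFreeSetoid Ω) Q) = Quotient.mk (convexPotentialSetoid Ω) s ↔
          HasWeakHessian Ω s.1 (fun x => rotRᵀ * Q.1 x * rotR) := by
      intro Q s
      set Q' := (Quotient.mk (divFreeSetoid Ω) Q).out
      have hQ : Q'.1 =ᵐ[volume.restrict Ω] Q.1 := Quotient.mk_out (s := divFreeSetoid Ω) Q
      have hH : HasWeakHessian Ω (σ Q').1 fun x => rotRᵀ * Q.1 x * rotR :=
        (hσ Q').congr EventuallyEq.rfl (by filter_upwards [hQ] with x hx; rw [hx])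
      constructor
      · intro h
        obtain ⟨a, ha⟩ := Quotient.exact (s := convexPotentialSetoid Ω) h
        exact hH.of_sub_affine hopen.measurableSet ha
      · intro h
        exact Quotient.sound ((σ Q').2.exists_affine hopen s.2 hH h)
    refine ⟨T, ⟨?_, ?_⟩, hT⟩
    · rintro ⟨Q⟩ ⟨Q'⟩ h
      obtain ⟨s, hs⟩ : ∃ s : ConvexPotential Ω, T (Quotient.mk (divFreeSetoid Ω) Q) =
        Quotient.mk (convexPotentialSetoid Ω) s := ⟨_, rfl⟩
      have h1 := (hT Q s).1 hs
      have h2 := (hT Q' s).1 (h.symm.trans hs)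
      refine Quotient.sound (s := divFreeSetoid Ω) ?_
      show Q.1 =ᵐ[volume.restrict Ω] Q'.1
      filter_upwards [h1.ae_eq hopen h2] with x hx
      exact rotR_conj_injective hx
    · rintro ⟨s⟩
      obtain ⟨Q, hQ, hH⟩ := s.2.exists_conductivity hopen
      exact ⟨Quotient.mk _ ⟨Q, hQ⟩, (hT ⟨Q, hQ⟩ s).2 hH⟩
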